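/- Let $p\ge q\ge 1$ be integers. Let $P^+(q)$ be the cone of real symmetric positive definite $q\times q$ matrices, let $\mu(\mathrm{d}S)=(\det S)^{-(q+1)/2}\prod_{1\le i\le j\le q}\mathrm{d}S_{ij}$ on $P^+(q)$, let $\Gamma_q(a)=\int_{P^+(q)}e^{-\operatorname{tr}S}(\det S)^{a}\,\mu(\mathrm{d}S)$ be the multivariate Gamma function and $c_{p,q}=\Gamma_q(p)/\Gamma_q(p/2)^2$. Let $\mathrm{d}\mathsf{U}$ be the uniform probability distribution on the set $\mathcal{O}(p,q)$ of real $p\times q$ matrices $\mathsf{U}$ with $\mathsf{U}^{\top}\mathsf{U}=I_q$ (the law of the first $q$ columns of a Haar distributed orthogonal $p\times p$ matrix), and let $\mathsf{U}_1$ be the matrix of the first $q$ rows of $\mathsf{U}$. For $\rho\in[0,1)$ let $$\mathcal{L}_\rho(\mathrm{d}\epsilon)=(1-\rho)^{pq/2}\,c_{p,q}\,\mu(\mathrm{d}\epsilon)\int_{\mathcal{O}(p,q)}\frac{\det(\epsilon)^{p/2}}{\det\big(I_q+\epsilon-\rho^{1/2}(\mathsf{U}_1\epsilon^{1/2}+\epsilon^{1/2}\mathsf{U}_1^{\top})\big)^{p}}\,\mathrm{d}\mathsf{U}$$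 be the law on $P^+(q)$ of the multiplicative noise $\epsilon$ of the MpCN proposal with parameter $\rho$. For $\rho=0$, $\mathcal{L}=\mathcal{L}_0$ is a probability measure on $P^+(q)$, and the ordered eigenvalues $\lambda_1\le\lambda_2\le\cdots\le\lambda_q$ of $\epsilon\sim\mathcal{L}$ have a joint density with respect to Lebesgue measure on $\mathbb{R}^q$, which is equal to $f/\int_{\mathbb{R}^q} f$, where $$f(\lambda_1,\ldots,\lambda_q)=\prod_{i=1}^q\frac{\lambda_i^{(p-q-1)/2}}{(1+\lambda_i)^{p}}\prod_{1\le i<j\le q}(\lambda_j-\lambda_i)\quad\text{if }0<\lambda_1\le\cdots\le\lambda_q,$$ and $f=0$ otherwise; here $0<\int_{\mathbb{R}^q} f<\infty$. -/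

import Mathlib

open MeasureTheory
open scoped ENNReal

/-- The entrywise (product) `σ`-algebra on real matrices; it is the Borel `σ`-algebra. -/
instance matrixMeasurableSpace (m n : Type*) : MeasurableSpace (Matrix m n ℝ) :=
  inferInstanceAs (MeasurableSpace (m → n → ℝ))

instance matrixBorelSpace (m n : Type*) [Countable m] [Countable n] :
    BorelSpace (Matrix m n ℝ) :=
  inferInstanceAs (BorelSpace (m → n → ℝ))

/-- The orthogonal group `O(p)` is compact. -/
instance orthogonalGroupCompactSpace (p : ℕ) :
    CompactSpace (Matrix.orthogonalGroup (Fin p) ℝ) := by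
  have hclosed : IsClosed
      (Matrix.orthogonalGroup (Fin p) ℝ : Set (Matrix (Fin p) (Fin p) ℝ)) := by
    have h : (Matrix.orthogonalGroup (Fin p) ℝ : Set (Matrix (Fin p) (Fin p) ℝ)) =
        {A | A * star A = 1} := by
      ext A
      exact Matrix.mem_unitaryGroup_iff
    rw [h]
    exact isClosed_eq (by fun_prop) continuous_const
  have hbox : IsCompact (Set.univ.pi fun _ : Fin p => Set.univ.pi fun _ : Fin p =>
      Set.Icc (-1 : ℝ) 1) :=
    isCompact_univ_pi fun _ => isCompact_univ_pi fun _ => isCompact_Icc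
  refine isCompact_iff_compactSpace.mp (hbox.of_isClosed_subset hclosed ?_)
  intro A hA i _ j _
  have h := entry_norm_bound_of_unitary hA i j
  rw [Real.norm_eq_abs] at h
  exact abs_le.mp h

noncomputable section

/-- The symmetric matrix whose entries on and above the diagonal are prescribed by `v`. -/
def symOfUpper (q : ℕ) (v : {ij : Fin q × Fin q // ij.1 ≤ ij.2} → ℝ) :
    Matrix (Fin q) (Fin q) ℝ :=
  fun i j => if h : i ≤ j then v ⟨(i, j), h⟩ else v ⟨(j, i), le_of_not_ge h⟩

/-- The Lebesgue measure `∏_{i ≤ j} dS_ij` carried by the symmetric `q × q` matrices. -/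
def lebSym (q : ℕ) : Measure (Matrix (Fin q) (Fin q) ℝ) :=
  (volume : Measure ({ij : Fin q × Fin q // ij.1 ≤ ij.2} → ℝ)).map (symOfUpper q)

/-- The measure `μ(dS) = (det S)^{-(q+1)/2} ∏_{i ≤ j} dS_ij` on the cone `P⁺(q)` of positive
definite matrices. -/
def muPos (q : ℕ) : Measure (Matrix (Fin q) (Fin q) ℝ) :=
  ((lebSym q).restrict {S | S.PosDef}).withDensity
    fun S => ENNReal.ofReal (S.det ^ (-((q : ℝ) + 1) / 2))

/-- The multivariate Gamma function
`Γ_q(a) = ∫_{P⁺(q)} exp(-tr S) (det S)^{a - (q+1)/2} ∏_{i ≤ j} dS_ij`, for `a > (q-1)/2`. -/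
def multivariateGamma (q : ℕ) (a : ℝ) : ℝ :=
  ∫ S in {S : Matrix (Fin q) (Fin q) ℝ | S.PosDef},
    Real.exp (-S.trace) * S.det ^ (a - ((q : ℝ) + 1) / 2) ∂(lebSym q)

/-- The constant `c_{p,q} = Γ_q(p) / Γ_q(p/2)²`. -/
def mpcnConst (p q : ℕ) : ℝ :=
  multivariateGamma q p / multivariateGamma q ((p : ℝ) / 2) ^ 2

/-- The uniform distribution on `O(p,q) = {U ∈ M(p,q) : Uᵀ U = I_q}`, `p ≥ q`: the law of the
first `q` columns of a Haar distributed element of `O(p)`. -/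
def uniformStiefel (p q : ℕ) (hqp : q ≤ p) : Measure (Matrix (Fin p) (Fin q) ℝ) :=
  (Measure.haarMeasure (⊤ : TopologicalSpace.PositiveCompacts
      (Matrix.orthogonalGroup (Fin p) ℝ))).map
    fun V : Matrix.orthogonalGroup (Fin p) ℝ => (V : Matrix (Fin p) (Fin p) ℝ).submatrix id (Fin.castLE hqp)

/-- The block `U₁` of the first `q` rows of a `p × q` matrix `U`. -/
def firstRows (p q : ℕ) (hqp : q ≤ p) (U : Matrix (Fin p) (Fin q) ℝ) :
    Matrix (Fin q) (Fin q) ℝ :=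
  U.submatrix (Fin.castLE hqp) id

open scoped MatrixOrder in
/-- The law `𝓛(dε)` on `P⁺(q)` of the multiplicative noise of the MpCN kernel with parameter
`ρ ∈ [0,1)`:
`(1-ρ)^{pq/2} c_{p,q} μ(dε) ∫_{O(p,q)} det(ε)^{p/2} /
  det(I_q + ε - ρ^{1/2} (U₁ ε^{1/2} + ε^{1/2} U₁ᵀ))^p dU`.
Here `CFC.sqrt ε` is the positive semidefinite square root of `ε`. -/
def mpcnNoiseLaw (p q : ℕ) (hqp : q ≤ p) (ρ : ℝ) : Measure (Matrix (Fin q) (Fin q) ℝ) :=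
  (muPos q).withDensity fun ε =>
    ENNReal.ofReal ((1 - ρ) ^ ((p : ℝ) * q / 2) * mpcnConst p q) *
      ∫⁻ U, ENNReal.ofReal (ε.det ^ ((p : ℝ) / 2) /
        (1 + ε - √ρ • (firstRows p q hqp U * CFC.sqrt ε +
          CFC.sqrt ε * (firstRows p q hqp U).transpose)).det ^ p) ∂(uniformStiefel p q hqp)

open scoped Classical in
/-- The eigenvalues `λ₁ ≤ ⋯ ≤ λ_q`, with multiplicity, of a symmetric matrix in nondecreasing
order (and `0` if the matrix is not symmetric). Mathlib's `eigenvalues₀` is nonincreasing. -/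
def orderedEigenvalues (q : ℕ) (S : Matrix (Fin q) (Fin q) ℝ) : Fin q → ℝ :=
  if h : S.IsHermitian then
    fun i => h.eigenvalues₀ (Fin.cast (Fintype.card_fin q).symm i.rev)
  else 0

open scoped Classical in
/-- The unnormalised density
`∏ᵢ λᵢ^{(p-q-1)/2} / (1+λᵢ)^p · ∏_{i<j} (λⱼ - λᵢ)` on `{0 < λ₁ ≤ ⋯ ≤ λ_q}`, extended by zero. -/
def eigenvalueWeight (p q : ℕ) (l : Fin q → ℝ) : ℝ :=
  if (∀ i, 0 < l i) ∧ Monotone l then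
    (∏ i, l i ^ (((p : ℝ) - q - 1) / 2) / (1 + l i) ^ p) *
      ∏ i, ∏ j ∈ Finset.Ioi i, (l j - l i)
  else 0

end

/-! ### Ordered eigenvalues: characterisation by the characteristic polynomial, invariance,
measurability. -/

section OrderedEigenvalues

/-! At `ρ = 0` the integrand does not depend on `U`, so the law has density proportional to
`det(S)^((p-q-1)/2) / det(1+S)^p` with respect to `lebSym` on the positive definite cone
(`mpcnNoiseLaw_zero`). This is a function of the eigenvalues alone, and Weyl's integration formula
(`exists_lintegral_orderedEigenvalues`) says that `lebSym` has, as image under the ordered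
eigenvalues, a constant multiple of the Vandermonde product on strictly increasing vectors. Hence
the eigenvalue law is `K • f`. Once the noise law is known to have mass one, `K * ∫ f = 1`, which
determines `K` and also shows that `f` is integrable with positive integral; the constant in Weyl's
formula is never computed.

Weyl's formula is proved with one local chart and an averaging argument. Near the identity,
orthogonal matrices are Cayley transforms of skew matrices `x`, and the Jacobian of `(x, λ) ↦ K
diag(λ) Kᵀ` factors as a function of `x` times the Vandermonde product (`hasFDerivAt_spectralMap`,
`abs_det_spectralDeriv`). Let `W` be the image of this chart. For a conjugation-invariant `φ`,
Fubini gives `∫ φ(S) * Haar{O | Oᵀ S O ∈ W} = ∫_W φ` (`lintegral_mul_haar_conj_mem`). The Haar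
factor is the same positive number for every `S` with simple spectrum, and almost every `S` has
simple spectrum, so the integral over the chart gives the integral over all symmetric matrices.

Total mass one is the matrix Beta integral: `∫∫ det(E)^b exp(-tr((1+E)S)) det(S)^d` is evaluated in
both orders by means of the Laplace-type formula `lintegral_exp_neg_trace_mul`. To divide by the
Gamma integrals one needs them nonzero and finite, which is Weyl's formula again together with a
crude bound on the Vandermonde product. -/

open scoped Classical in
theorem exists_equiv_orderedEigenvalues_eq {q : ℕ} {S : Matrix (Fin q) (Fin q) ℝ}
    (hS : S.IsHermitian) :
    ∃ e : Fin q ≃ Fin q, ∀ i, orderedEigenvalues q S i = hS.eigenvalues (e i) := by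
  refine ⟨(Fin.revPerm.trans (finCongr (Fintype.card_fin q).symm)).trans
    (Fintype.equivOfCardEq (Fintype.card_fin _)), fun i => ?_⟩
  rw [orderedEigenvalues, dif_pos hS]
  simp [Matrix.IsHermitian.eigenvalues]

open Polynomial in
theorem orderedEigenvalues_charpoly {q : ℕ} {S : Matrix (Fin q) (Fin q) ℝ} (hS : S.IsHermitian) :
    S.charpoly = ∏ i, (X - C (orderedEigenvalues q S i)) := by
  classical
  obtain ⟨e, he⟩ := exists_equiv_orderedEigenvalues_eq hS
  rw [hS.charpoly_eq, ← Equiv.prod_comp e]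
  simp [he]

theorem orderedEigenvalues_monotone (q : ℕ) (S : Matrix (Fin q) (Fin q) ℝ) :
    Monotone (orderedEigenvalues q S) := by
  intro i j hij
  unfold orderedEigenvalues
  split_ifs with h
  · apply h.eigenvalues₀_antitone
    simpa [Fin.le_def] using Fin.rev_le_rev.mpr hij
  · simp

-- Equal products have the same multiset of roots, and a sorted list is determined by its multiset.
open Polynomial in
theorem monotone_eq_of_prod_X_sub_C_eq {q : ℕ} {l l' : Fin q → ℝ} (hl : Monotone l)
    (hl' : Monotone l') (h : ∏ i, (X - C (l i)) = ∏ i, (X - C (l' i))) : l = l' := by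
  have hm : Finset.univ.val.map l = Finset.univ.val.map l' := by
    have := congrArg Polynomial.roots h
    rw [Polynomial.roots_prod _ _ (Finset.prod_ne_zero_iff.mpr fun i _ => X_sub_C_ne_zero _),
      Polynomial.roots_prod _ _ (Finset.prod_ne_zero_iff.mpr fun i _ => X_sub_C_ne_zero _)] at this
    simpa only [roots_X_sub_C, Multiset.bind_singleton] using this
  have hp : (List.ofFn l).Perm (List.ofFn l') := by
    rw [← Multiset.coe_eq_coe]
    simpa [Fin.univ_val_map] using hm
  exact List.ofFn_injective
    (hp.eq_of_pairwise' hl.sortedLE_ofFn.pairwise hl'.sortedLE_ofFn.pairwise)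

open Polynomial in
theorem orderedEigenvalues_eq_of_charpoly {q : ℕ} {S : Matrix (Fin q) (Fin q) ℝ}
    (hS : S.IsHermitian) {l : Fin q → ℝ} (hl : Monotone l)
    (h : S.charpoly = ∏ i, (X - C (l i))) : orderedEigenvalues q S = l :=
  monotone_eq_of_prod_X_sub_C_eq (orderedEigenvalues_monotone q S) hl
    ((orderedEigenvalues_charpoly hS).symm.trans h)

theorem orthogonal_mul_transpose {q : ℕ} (O : Matrix.orthogonalGroup (Fin q) ℝ) :
    (O : Matrix (Fin q) (Fin q) ℝ) * (O : Matrix (Fin q) (Fin q) ℝ).transpose = 1 :=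
  Matrix.mem_orthogonalGroup_iff (Fin q) ℝ |>.mp O.2

theorem orthogonal_transpose_mul {q : ℕ} (O : Matrix.orthogonalGroup (Fin q) ℝ) :
    (O : Matrix (Fin q) (Fin q) ℝ).transpose * (O : Matrix (Fin q) (Fin q) ℝ) = 1 :=
  Matrix.mem_orthogonalGroup_iff' (Fin q) ℝ |>.mp O.2

theorem isHermitian_conj {q : ℕ} {S : Matrix (Fin q) (Fin q) ℝ} (hS : S.IsHermitian)
    (B : Matrix (Fin q) (Fin q) ℝ) : (B * S * B.transpose).IsHermitian := by
  have h : S.transpose = S := hS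
  show (B * S * B.transpose).transpose = _
  simp [Matrix.transpose_mul, h, Matrix.mul_assoc]

theorem charpoly_conj_orthogonal {q : ℕ} (S O : Matrix (Fin q) (Fin q) ℝ)
    (hO : O.transpose * O = 1) : (O * S * O.transpose).charpoly = S.charpoly := by
  rw [Matrix.mul_assoc, Matrix.charpoly_mul_comm, Matrix.mul_assoc, hO, Matrix.mul_one]

theorem orderedEigenvalues_conj {q : ℕ} {S : Matrix (Fin q) (Fin q) ℝ} (hS : S.IsHermitian)
    (O : Matrix.orthogonalGroup (Fin q) ℝ) :
    orderedEigenvalues q (O * S * (O : Matrix (Fin q) (Fin q) ℝ).transpose) =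
      orderedEigenvalues q S :=
  orderedEigenvalues_eq_of_charpoly (isHermitian_conj hS _) (orderedEigenvalues_monotone q S)
    ((charpoly_conj_orthogonal S _ (orthogonal_transpose_mul O)).trans
      (orderedEigenvalues_charpoly hS))

theorem orderedEigenvalues_conj_diagonal {q : ℕ} {l : Fin q → ℝ} (hl : Monotone l)
    {O : Matrix (Fin q) (Fin q) ℝ} (hO : O.transpose * O = 1) :
    orderedEigenvalues q (O * Matrix.diagonal l * O.transpose) = l :=
  orderedEigenvalues_eq_of_charpoly (isHermitian_conj (Matrix.isHermitian_diagonal l) _) hl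
    ((charpoly_conj_orthogonal _ _ hO).trans (Matrix.charpoly_diagonal l))

theorem exists_orthogonal_diagonalization {q : ℕ} {S : Matrix (Fin q) (Fin q) ℝ}
    (hS : S.IsHermitian) : ∃ O : Matrix.orthogonalGroup (Fin q) ℝ,
      S = O * Matrix.diagonal (orderedEigenvalues q S) *
        (O : Matrix (Fin q) (Fin q) ℝ).transpose := by
  classical
  obtain ⟨e, he⟩ := exists_equiv_orderedEigenvalues_eq hS
  set Q : Matrix.orthogonalGroup (Fin q) ℝ := hS.eigenvectorUnitary with hQ
  refine ⟨⟨(Q : Matrix (Fin q) (Fin q) ℝ).submatrix id e, ?_⟩, ?_⟩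
  · rw [Matrix.mem_orthogonalGroup_iff]
    show _ * ((Q : Matrix (Fin q) (Fin q) ℝ).submatrix id e).transpose = 1
    rw [Matrix.transpose_submatrix, Matrix.submatrix_mul_equiv, orthogonal_mul_transpose,
      Matrix.submatrix_id_id]
  · have h1 : Matrix.diagonal (orderedEigenvalues q S) =
        (Matrix.diagonal hS.eigenvalues).submatrix e e := by
      rw [Matrix.submatrix_diagonal_equiv]; congr 1; ext i; exact he i
    change S = (Q : Matrix (Fin q) (Fin q) ℝ).submatrix id e * _ *
      ((Q : Matrix (Fin q) (Fin q) ℝ).submatrix id e).transpose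
    rw [h1, Matrix.transpose_submatrix, Matrix.submatrix_mul_equiv, Matrix.submatrix_mul_equiv]
    conv_lhs => rw [hS.spectral_theorem, Unitary.conjStarAlgAut_apply]
    rfl

theorem det_eq_prod_orderedEigenvalues {q : ℕ} {S : Matrix (Fin q) (Fin q) ℝ}
    (hS : S.IsHermitian) : S.det = ∏ i, orderedEigenvalues q S i := by
  obtain ⟨O, hO⟩ := exists_orthogonal_diagonalization hS
  conv_lhs => rw [hO]
  rw [Matrix.det_mul_right_comm, orthogonal_mul_transpose, Matrix.one_mul, Matrix.det_diagonal]

theorem trace_eq_sum_orderedEigenvalues {q : ℕ} {S : Matrix (Fin q) (Fin q) ℝ}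
    (hS : S.IsHermitian) : S.trace = ∑ i, orderedEigenvalues q S i := by
  obtain ⟨O, hO⟩ := exists_orthogonal_diagonalization hS
  conv_lhs => rw [hO]
  rw [Matrix.mul_assoc, Matrix.trace_mul_comm, Matrix.mul_assoc, orthogonal_transpose_mul,
    Matrix.mul_one, Matrix.trace_diagonal]

theorem det_one_add_eq_prod_orderedEigenvalues {q : ℕ} {S : Matrix (Fin q) (Fin q) ℝ}
    (hS : S.IsHermitian) : (1 + S).det = ∏ i, (1 + orderedEigenvalues q S i) := by
  obtain ⟨O, hO⟩ := exists_orthogonal_diagonalization hS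
  have : 1 + S = O * Matrix.diagonal (fun i => 1 + orderedEigenvalues q S i) *
        (O : Matrix (Fin q) (Fin q) ℝ).transpose := by
    rw [← Matrix.diagonal_add, Matrix.mul_add, Matrix.add_mul, ← hO]
    congr 1
    change _ = _ * Matrix.diagonal (1 : Fin q → ℝ) * _
    rw [show Matrix.diagonal (1 : Fin q → ℝ) = 1 from Matrix.diagonal_one, Matrix.mul_one,
      orthogonal_mul_transpose]
  rw [this, Matrix.det_mul_right_comm, orthogonal_mul_transpose, Matrix.one_mul,
    Matrix.det_diagonal]

theorem posDef_iff_orderedEigenvalues_pos {q : ℕ} {S : Matrix (Fin q) (Fin q) ℝ} :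
    S.PosDef ↔ S.IsHermitian ∧ ∀ i, 0 < orderedEigenvalues q S i := by
  classical
  constructor
  · intro h
    refine ⟨h.1, fun i => ?_⟩
    have h2 : Polynomial.IsRoot S.charpoly (orderedEigenvalues q S i) := by
      rw [orderedEigenvalues_charpoly h.1, Polynomial.IsRoot, Polynomial.eval_prod]
      exact Finset.prod_eq_zero (Finset.mem_univ i) (by simp)
    rw [h.1.charpoly_eq, Polynomial.IsRoot, Polynomial.eval_prod, Finset.prod_eq_zero_iff] at h2
    obtain ⟨j, -, hj⟩ := h2
    have h3 := h.eigenvalues_pos j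
    simp at hj
    linarith
  · rintro ⟨h, hp⟩
    rw [h.posDef_iff_eigenvalues_pos]
    intro i
    have h2 : Polynomial.IsRoot S.charpoly (h.eigenvalues i) := by
      rw [h.charpoly_eq, Polynomial.IsRoot, Polynomial.eval_prod]
      exact Finset.prod_eq_zero (Finset.mem_univ i) (by simp)
    rw [orderedEigenvalues_charpoly h, Polynomial.IsRoot, Polynomial.eval_prod,
      Finset.prod_eq_zero_iff] at h2
    obtain ⟨j, -, hj⟩ := h2
    have h3 := hp j
    simp at hj
    linarith

theorem isClosed_isHermitian (q : ℕ) :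
    IsClosed {S : Matrix (Fin q) (Fin q) ℝ | S.IsHermitian} := by
  show IsClosed {S : Matrix (Fin q) (Fin q) ℝ | S.conjTranspose = S}
  exact isClosed_eq (by fun_prop) continuous_id

/-- The graph over the Hermitian matrices is closed, being cut out by monotonicity and the values of
the characteristic polynomial. Preimages are projections of Borel parts of this graph, and the
projection is injective there, so its images are Borel (Lusin–Souslin). Off the Hermitian matrices
the function is constantly `0`. -/
theorem measurable_orderedEigenvalues (q : ℕ) : Measurable (orderedEigenvalues q) := by
  classical
  let G : Set ((Fin q → Fin q → ℝ) × (Fin q → ℝ)) := {x | (Matrix.of x.1).IsHermitian ∧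
    Monotone x.2 ∧ ∀ t : ℝ, (Matrix.scalar (Fin q) t - Matrix.of x.1).det = ∏ i, (t - x.2 i)}
  have hG : ∀ x, x ∈ G ↔ (Matrix.of x.1).IsHermitian ∧
      orderedEigenvalues q (Matrix.of x.1) = x.2 := by
    intro x
    constructor
    · rintro ⟨h1, h2, h3⟩
      refine ⟨h1, orderedEigenvalues_eq_of_charpoly h1 h2 (Polynomial.funext fun t => ?_)⟩
      rw [Matrix.eval_charpoly, h3]
      simp [Polynomial.eval_prod]
    · rintro ⟨h1, h2⟩
      refine ⟨h1, h2 ▸ orderedEigenvalues_monotone q _, fun t => ?_⟩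
      rw [← Matrix.eval_charpoly, orderedEigenvalues_charpoly h1, h2]
      simp [Polynomial.eval_prod]
  have hGc : MeasurableSet G := by
    apply IsClosed.measurableSet
    refine IsClosed.inter ?_ (IsClosed.inter ?_ ?_)
    · exact (isClosed_isHermitian q).preimage (f := fun x : (Fin q → Fin q → ℝ) × (Fin q → ℝ) =>
        (Matrix.of x.1)) (by exact continuous_fst)
    · have : {x : (Fin q → Fin q → ℝ) × (Fin q → ℝ) | Monotone x.2} =
          ⋂ (i) (j) (_ : i ≤ j), {x | x.2 i ≤ x.2 j} := by
        ext x; simp [Monotone]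
      change IsClosed {x : (Fin q → Fin q → ℝ) × (Fin q → ℝ) | Monotone x.2}
      rw [this]
      exact isClosed_iInter fun i => isClosed_iInter fun j => isClosed_iInter fun _ =>
        isClosed_le (by fun_prop) (by fun_prop)
    · change IsClosed {x : (Fin q → Fin q → ℝ) × (Fin q → ℝ) | ∀ t : ℝ, _}
      rw [Set.ofPred_forall]
      refine isClosed_iInter fun t => isClosed_eq ?_ (by fun_prop)
      refine Continuous.matrix_det (continuous_const.sub ?_)
      exact continuous_fst
  intro B hB
  have h1 : orderedEigenvalues q ⁻¹' B =
      (Prod.fst '' (G ∩ Prod.snd ⁻¹' B) : Set (Fin q → Fin q → ℝ)) ∪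
        ({S : Matrix (Fin q) (Fin q) ℝ | ¬ S.IsHermitian} ∩ {_S | (0 : Fin q → ℝ) ∈ B}) := by
    ext S
    by_cases hS : S.IsHermitian
    · constructor
      · intro h
        exact Or.inl ⟨(S, orderedEigenvalues q S), ⟨(hG _).2 ⟨hS, rfl⟩, h⟩, rfl⟩
      · rintro (⟨x, ⟨hx, hxB⟩, rfl⟩ | h)
        · have := ((hG x).1 hx).2
          change orderedEigenvalues q (Matrix.of x.1) ∈ B
          rw [this]; exact hxB
        · exact absurd hS h.1
    · have h0 : orderedEigenvalues q S = 0 := by rw [orderedEigenvalues, dif_neg hS]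
      constructor
      · intro h
        refine Or.inr ⟨hS, ?_⟩
        rwa [Set.mem_preimage, h0] at h
      · rintro (⟨x, ⟨hx, hxB⟩, rfl⟩ | h)
        · exact absurd ((hG x).1 hx).1 hS
        · rw [Set.mem_preimage, h0]; exact h.2
  rw [h1]
  refine MeasurableSet.union ?_ (MeasurableSet.inter ?_ (MeasurableSet.const _))
  · have : MeasurableSet (Prod.fst '' (G ∩ Prod.snd ⁻¹' B) : Set (Fin q → Fin q → ℝ)) := by
      refine (hGc.inter (measurable_snd hB)).image_of_continuousOn_injOn
        continuous_fst.continuousOn ?_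
      rintro ⟨a, b⟩ hx ⟨c, d⟩ hy (rfl : a = c)
      exact Prod.ext rfl (((hG _).1 hx.1).2.symm.trans ((hG _).1 hy.1).2)
    exact this
  · exact (isClosed_isHermitian q).measurableSet.compl

theorem measurableSet_posDef (q : ℕ) :
    MeasurableSet {S : Matrix (Fin q) (Fin q) ℝ | S.PosDef} := by
  have : {S : Matrix (Fin q) (Fin q) ℝ | S.PosDef} = {S | S.IsHermitian} ∩
      ⋂ i, {S | 0 < orderedEigenvalues q S i} := by
    ext S; simp [posDef_iff_orderedEigenvalues_pos]
  rw [this]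
  refine (isClosed_isHermitian q).measurableSet.inter (MeasurableSet.iInter fun i => ?_)
  exact measurableSet_lt measurable_const
    ((measurable_pi_apply i).comp (measurable_orderedEigenvalues q))

end OrderedEigenvalues

/-! ### Linear coordinates on symmetric matrices and the Jacobian of congruence. -/

section SymmetricCoordinates

/-- The positions strictly above the diagonal. -/
abbrev StrictUpper (q : ℕ) : Type := {ij : Fin q × Fin q // ij.1 < ij.2}

/-- Coordinates of a symmetric matrix: the entries above the diagonal and those on it. -/
abbrev SymCoord (q : ℕ) : Type := (StrictUpper q → ℝ) × (Fin q → ℝ)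

/-- The symmetric matrix with given coordinates. -/
def symMat (q : ℕ) : SymCoord q →ₗ[ℝ] Matrix (Fin q) (Fin q) ℝ where
  toFun v := Matrix.of fun i j => if h : i < j then v.1 ⟨(i, j), h⟩ else
    if h : j < i then v.1 ⟨(j, i), h⟩ else v.2 i
  map_add' v w := by
    ext i j
    simp only [Matrix.add_apply, Matrix.of_apply]
    split_ifs <;> rfl
  map_smul' c v := by
    ext i j
    simp only [Matrix.smul_apply, Matrix.of_apply]
    split_ifs <;> rfl

/-- The entries of a matrix above and on the diagonal. -/
def upperPart (q : ℕ) : Matrix (Fin q) (Fin q) ℝ →ₗ[ℝ] SymCoord q where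
  toFun M := (fun ij => M ij.1.1 ij.1.2, fun i => M i i)
  map_add' _ _ := rfl
  map_smul' _ _ := rfl

instance isAddHaarMeasure_volume_symCoord (q : ℕ) :
    (volume : Measure (SymCoord q)).IsAddHaarMeasure :=
  Measure.prod.instIsAddHaarMeasure volume volume

theorem symMat_apply {q : ℕ} (v : SymCoord q) (i j : Fin q) :
    symMat q v i j = if h : i < j then v.1 ⟨(i, j), h⟩ else
      if h : j < i then v.1 ⟨(j, i), h⟩ else v.2 i := rfl

theorem upperPart_fst {q : ℕ} (M : Matrix (Fin q) (Fin q) ℝ) (ij : StrictUpper q) :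
    (upperPart q M).1 ij = M ij.1.1 ij.1.2 := rfl

theorem upperPart_snd {q : ℕ} (M : Matrix (Fin q) (Fin q) ℝ) (i : Fin q) :
    (upperPart q M).2 i = M i i := rfl

theorem upperPart_symMat {q : ℕ} (v : SymCoord q) : upperPart q (symMat q v) = v := by
  refine Prod.ext (funext fun ij => ?_) (funext fun i => ?_)
  · exact dif_pos ij.2
  · simp [upperPart_snd, symMat_apply]

theorem symMat_isHermitian {q : ℕ} (v : SymCoord q) : (symMat q v).IsHermitian := by
  ext i j
  simp only [Matrix.conjTranspose_apply, star_trivial, symMat_apply]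
  rcases lt_trichotomy i j with h | rfl | h
  · simp [h, h.le]
  · simp
  · simp [h, h.le]

theorem symMat_upperPart {q : ℕ} {M : Matrix (Fin q) (Fin q) ℝ} (hM : M.IsHermitian) :
    symMat q (upperPart q M) = M := by
  ext i j
  rw [symMat_apply]
  rcases lt_trichotomy i j with h | rfl | h
  · simp [h, upperPart_fst]
  · simp [upperPart_snd]
  · have := hM.apply i j
    simpa [h, h.not_gt, upperPart_fst] using this

theorem continuous_symMat (q : ℕ) : Continuous (symMat q) :=
  (symMat q).continuous_of_finiteDimensional

theorem continuous_upperPart (q : ℕ) : Continuous (upperPart q) :=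
  (upperPart q).continuous_of_finiteDimensional

/-- Separating diagonal from off-diagonal coordinates is a linear isomorphism, so it carries one
additive Haar measure to a multiple of another. The value of the multiple plays no role later. -/
theorem exists_lebSym_eq_smul_map (q : ℕ) :
    ∃ k : ℝ≥0∞, k ≠ 0 ∧ k ≠ ∞ ∧
      lebSym q = k • (volume : Measure (SymCoord q)).map (symMat q) := by
  let e : ({ij : Fin q × Fin q // ij.1 ≤ ij.2} → ℝ) ≃ₗ[ℝ] SymCoord q :=
    { toFun := fun v => (fun ij => v ⟨ij.1, ij.2.le⟩, fun i => v ⟨(i, i), le_refl i⟩)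
      map_add' := fun _ _ => rfl
      map_smul' := fun _ _ => rfl
      invFun := fun v ij => symMat q v ij.1.1 ij.1.2
      left_inv := by
        intro v
        funext ij
        rcases ij with ⟨⟨i, j⟩, h⟩
        rcases lt_or_eq_of_le h with h | h
        · exact (symMat_apply _ _ _).trans (dif_pos h)
        · simp only at h
          subst h
          simp [symMat_apply]
      right_inv := fun v => upperPart_symMat v }
  have he1 : ∀ v ij, (e v).1 ij = v ⟨ij.1, ij.2.le⟩ := fun _ _ => rfl
  have he2 : ∀ v i, (e v).2 i = v ⟨(i, i), le_refl i⟩ := fun _ _ => rfl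
  have he : symOfUpper q = symMat q ∘ e.toContinuousLinearEquiv := by
    funext v
    ext i j
    rw [Function.comp_apply, LinearEquiv.coe_toContinuousLinearEquiv', symMat_apply, symOfUpper]
    rcases lt_trichotomy i j with h | rfl | h
    · simp [h, h.le, he1]
    · simp [he2]
    · simp [h, h.not_gt, h.not_ge, he1]
  have hH : ((volume : Measure ({ij : Fin q × Fin q // ij.1 ≤ ij.2} → ℝ)).map
      e.toContinuousLinearEquiv).IsAddHaarMeasure := inferInstance
  have hk := Measure.isAddLeftInvariant_eq_smul
    ((volume : Measure ({ij : Fin q × Fin q // ij.1 ≤ ij.2} → ℝ)).map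
      e.toContinuousLinearEquiv) (volume : Measure (SymCoord q))
  refine ⟨_, ENNReal.coe_ne_zero.mpr (Measure.addHaarScalarFactor_pos_of_isAddHaarMeasure
    ((volume : Measure ({ij : Fin q × Fin q // ij.1 ≤ ij.2} → ℝ)).map
      e.toContinuousLinearEquiv) (volume : Measure (SymCoord q))).ne',
    ENNReal.coe_ne_top, ?_⟩
  rw [lebSym, he, ← Measure.map_map (continuous_symMat q).measurable
    e.toContinuousLinearEquiv.continuous.measurable]
  refine (congrArg (Measure.map _) hk).trans ?_
  rw [Measure.map_smul]
  rfl

instance sFinite_lebSym (q : ℕ) : SFinite (lebSym q) := by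
  unfold lebSym; infer_instance

theorem ae_lebSym_isHermitian (q : ℕ) : ∀ᵐ S ∂(lebSym q), S.IsHermitian := by
  obtain ⟨k, -, -, hk⟩ := exists_lebSym_eq_smul_map q
  rw [hk]
  apply Measure.ae_smul_measure
  rw [ae_map_iff (continuous_symMat q).measurable.aemeasurable
    (isClosed_isHermitian q).measurableSet]
  exact Filter.Eventually.of_forall symMat_isHermitian

theorem prod_strictUpper {q : ℕ} (f : Fin q → Fin q → ℝ) :
    ∏ ij : StrictUpper q, f ij.1.1 ij.1.2 = ∏ i, ∏ j ∈ Finset.Ioi i, f i j := by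
  rw [Finset.prod_sigma']
  refine Finset.prod_bij' (fun ij _ => ⟨ij.1.1, ij.1.2⟩)
    (fun x hx => ⟨(x.1, x.2), by simpa using hx⟩) ?_ ?_ ?_ ?_ ?_ <;> simp

theorem det_toLin'_diagonal {ι : Type*} [Fintype ι] [DecidableEq ι] (a : ι → ℝ) :
    LinearMap.det (Matrix.toLin' (Matrix.diagonal a)) = ∏ i, a i := by
  rw [LinearMap.det_toLin', Matrix.det_diagonal]

/-- The congruence action `S ↦ B S Bᵀ` in coordinates. -/
def congruence {q : ℕ} (B : Matrix (Fin q) (Fin q) ℝ) : SymCoord q →ₗ[ℝ] SymCoord q :=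
  upperPart q ∘ₗ LinearMap.mulRight ℝ B.transpose ∘ₗ LinearMap.mulLeft ℝ B ∘ₗ symMat q

theorem congruence_apply {q : ℕ} (B : Matrix (Fin q) (Fin q) ℝ) (v : SymCoord q) :
    congruence B v = upperPart q (B * symMat q v * B.transpose) := rfl

theorem symMat_congruence {q : ℕ} (B : Matrix (Fin q) (Fin q) ℝ) (v : SymCoord q) :
    symMat q (congruence B v) = B * symMat q v * B.transpose :=
  symMat_upperPart (isHermitian_conj (symMat_isHermitian v) B)

theorem congruence_mul {q : ℕ} (A B : Matrix (Fin q) (Fin q) ℝ) :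
    congruence (A * B) = congruence A * congruence B := by
  refine LinearMap.ext fun v => ?_
  rw [Module.End.mul_apply, congruence_apply, congruence_apply, symMat_congruence,
    Matrix.transpose_mul]
  simp only [Matrix.mul_assoc]

theorem congruence_one (q : ℕ) : congruence (1 : Matrix (Fin q) (Fin q) ℝ) = 1 := by
  refine LinearMap.ext fun v => ?_
  simp [congruence_apply, upperPart_symMat]

theorem det_congruence_diagonal {q : ℕ} (d : Fin q → ℝ) :
    LinearMap.det (congruence (Matrix.diagonal d)) = (∏ i, d i) ^ (q + 1) := by
  have h : congruence (Matrix.diagonal d) =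
      (Matrix.toLin' (Matrix.diagonal fun ij : StrictUpper q => d ij.1.1 * d ij.1.2)).prodMap
        (Matrix.toLin' (Matrix.diagonal fun i => d i * d i)) := by
    refine LinearMap.ext fun v => Prod.ext (funext fun ij => ?_) (funext fun i => ?_)
    · have := congrFun (congrArg Prod.fst (upperPart_symMat v)) ij
      simp only [congruence_apply, Matrix.diagonal_transpose, LinearMap.prodMap_apply,
        Matrix.toLin'_apply, Matrix.mulVec_diagonal]
      rw [← this]
      simp only [upperPart_fst, Matrix.mul_diagonal, Matrix.diagonal_mul]
      ring
    · have := congrFun (congrArg Prod.snd (upperPart_symMat v)) i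
      simp only [congruence_apply, Matrix.diagonal_transpose, LinearMap.prodMap_apply,
        Matrix.toLin'_apply, Matrix.mulVec_diagonal]
      rw [← this]
      simp only [upperPart_snd, Matrix.mul_diagonal, Matrix.diagonal_mul]
      ring
  rw [h, LinearMap.det_prodMap, det_toLin'_diagonal, det_toLin'_diagonal,
    prod_strictUpper (fun i j => d i * d j),
    Finset.prod_prod_Ioi_mul_eq_prod_prod_off_diag (fun _ i => d i), ← Finset.prod_mul_distrib,
    ← Finset.prod_pow]
  refine Finset.prod_congr rfl fun i _ => ?_
  rw [Finset.prod_const, Finset.card_compl, Finset.card_singleton, Fintype.card_fin]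
  obtain ⟨n, rfl⟩ : ∃ n, q = n + 1 := ⟨q - 1, by have := i.pos; omega⟩
  rw [Nat.add_sub_cancel]
  ring

/-- Let `D` be diagonal with entry `2` at `i` and `1` elsewhere. Conjugation by `D` doubles the
off-diagonal entry of the transvection `T`, that is `D T = T² D`. Taking determinants of the
congruences gives `t = t²` with `t ≠ 0`. -/
theorem det_congruence_transvection {q : ℕ} {i j : Fin q} (hij : i ≠ j) (c : ℝ) :
    LinearMap.det (congruence (Matrix.transvection i j c)) = 1 := by
  set D : Matrix (Fin q) (Fin q) ℝ := Matrix.diagonal (Function.update 1 i 2) with hD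
  have hD0 : LinearMap.det (congruence D) ≠ 0 := by
    rw [hD, det_congruence_diagonal]
    refine pow_ne_zero _ (Finset.prod_ne_zero_iff.mpr fun k _ => ?_)
    by_cases hk : k = i
    · subst hk; simp
    · simp [hk]
  have hcomm : D * Matrix.transvection i j c =
      Matrix.transvection i j c * Matrix.transvection i j c * D := by
    rw [Matrix.transvection_mul_transvection_same _ _ hij]
    ext a b
    rw [hD, Matrix.diagonal_mul, Matrix.mul_diagonal]
    simp only [Matrix.transvection, Matrix.add_apply, Matrix.one_apply, Matrix.single_apply,
      Function.update_apply, Pi.one_apply]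
    by_cases ha : a = i <;> by_cases hb : b = j <;> by_cases hab : a = b <;>
      by_cases hb' : b = i <;> grind
  have h1 := congrArg (fun M => LinearMap.det (congruence M)) hcomm
  simp only [congruence_mul, map_mul] at h1
  have hx0 : LinearMap.det (congruence (Matrix.transvection i j c)) ≠ 0 := by
    intro h0
    have h2 := congrArg (fun M => LinearMap.det (congruence M))
      (Matrix.transvection_mul_transvection_same _ _ hij c (-c))
    simp [congruence_mul, h0, congruence_one] at h2
  have h3 : LinearMap.det (congruence (Matrix.transvection i j c)) *
      (LinearMap.det (congruence (Matrix.transvection i j c)) * LinearMap.det (congruence D)) =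
      LinearMap.det (congruence (Matrix.transvection i j c)) * LinearMap.det (congruence D) := by
    linarith
  exact mul_right_cancel₀ (mul_ne_zero hx0 hD0) (h3.trans (one_mul _).symm)

/-- Both sides are multiplicative in `B`, so diagonal matrices and transvections suffice. -/
theorem det_congruence {q : ℕ} (B : Matrix (Fin q) (Fin q) ℝ) :
    LinearMap.det (congruence B) = B.det ^ (q + 1) := by
  refine Matrix.diagonal_transvection_induction
    (fun B => LinearMap.det (congruence B) = B.det ^ (q + 1)) B ?_ ?_ ?_
  · intro d _
    rw [det_congruence_diagonal, Matrix.det_diagonal]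
  · intro t
    rw [Matrix.TransvectionStruct.det, one_pow]
    exact det_congruence_transvection t.hij t.c
  · intro A B hA hB
    rw [congruence_mul, map_mul, hA, hB, Matrix.det_mul, mul_pow]

theorem measurable_conj {q : ℕ} (B : Matrix (Fin q) (Fin q) ℝ) :
    Measurable fun S : Matrix (Fin q) (Fin q) ℝ => B * S * B.transpose :=
  Continuous.measurable (by fun_prop)

theorem map_lebSym_conj {q : ℕ} {B : Matrix (Fin q) (Fin q) ℝ} (hB : B.det ≠ 0) :
    (lebSym q).map (fun S => B * S * B.transpose) =
      ENNReal.ofReal |(B.det ^ (q + 1))⁻¹| • lebSym q := by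
  obtain ⟨k, -, -, hk⟩ := exists_lebSym_eq_smul_map q
  have hdet : LinearMap.det (congruence B) ≠ 0 := by
    rw [det_congruence]; exact pow_ne_zero _ hB
  have hmap := Measure.map_linearMap_addHaar_eq_smul_addHaar (volume : Measure (SymCoord q)) hdet
  have hm : Measurable (congruence B) :=
    ((congruence B).continuous_of_finiteDimensional).measurable
  rw [hk, Measure.map_smul, Measure.map_map (measurable_conj B) (continuous_symMat q).measurable,
    show (fun S => B * S * B.transpose) ∘ symMat q = symMat q ∘ congruence B from
      funext fun v => (symMat_congruence B v).symm,
    ← Measure.map_map (continuous_symMat q).measurable hm, hmap, Measure.map_smul, det_congruence,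
    smul_comm]

theorem lintegral_lebSym_conj {q : ℕ} {B : Matrix (Fin q) (Fin q) ℝ} (hB : B.det ≠ 0)
    {g : Matrix (Fin q) (Fin q) ℝ → ℝ≥0∞} (hg : Measurable g) :
    ∫⁻ S, g (B * S * B.transpose) ∂(lebSym q) =
      ENNReal.ofReal |(B.det ^ (q + 1))⁻¹| * ∫⁻ S, g S ∂(lebSym q) := by
  rw [← lintegral_map hg (measurable_conj B), map_lebSym_conj hB, lintegral_smul_measure,
    smul_eq_mul]

theorem lintegral_lebSym_conj_orthogonal {q : ℕ} (O : Matrix.orthogonalGroup (Fin q) ℝ)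
    {g : Matrix (Fin q) (Fin q) ℝ → ℝ≥0∞} (hg : Measurable g) :
    ∫⁻ S, g (O * S * (O : Matrix (Fin q) (Fin q) ℝ).transpose) ∂(lebSym q) =
      ∫⁻ S, g S ∂(lebSym q) := by
  have h1 : (O : Matrix (Fin q) (Fin q) ℝ).det ^ 2 = 1 := by
    have := congrArg Matrix.det (orthogonal_mul_transpose O)
    rwa [Matrix.det_mul, Matrix.det_transpose, Matrix.det_one, ← sq] at this
  have h2 : |(O : Matrix (Fin q) (Fin q) ℝ).det| = 1 := by
    rcases mul_self_eq_one_iff.mp ((sq _).symm.trans h1) with h | h <;> simp [h]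
  rw [lintegral_lebSym_conj (fun h => by simp [h] at h2) hg, abs_inv, abs_pow, h2]
  simp

end SymmetricCoordinates

/-! ### The Cayley transform of skew-symmetric matrices. -/

section Cayley

/-- The skew-symmetric matrix with given entries above the diagonal. -/
def skewMat (q : ℕ) : (StrictUpper q → ℝ) →ₗ[ℝ] Matrix (Fin q) (Fin q) ℝ where
  toFun x := Matrix.of fun i j => if h : i < j then x ⟨(i, j), h⟩ else
    if h : j < i then -x ⟨(j, i), h⟩ else 0
  map_add' v w := by
    ext i j
    simp only [Matrix.add_apply, Matrix.of_apply]
    split_ifs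
    · rfl
    · exact neg_add _ _
    · simp
  map_smul' c v := by
    ext i j
    simp only [Matrix.smul_apply, Matrix.of_apply]
    split_ifs
    · rfl
    · exact (smul_neg c (v _)).symm
    · simp

theorem skewMat_apply {q : ℕ} (x : StrictUpper q → ℝ) (i j : Fin q) :
    skewMat q x i j = if h : i < j then x ⟨(i, j), h⟩ else
      if h : j < i then -x ⟨(j, i), h⟩ else 0 := rfl

theorem continuous_skewMat (q : ℕ) : Continuous (skewMat q) :=
  (skewMat q).continuous_of_finiteDimensional

theorem skewMat_transpose {q : ℕ} (x : StrictUpper q → ℝ) :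
    (skewMat q x).transpose = -skewMat q x := by
  ext i j
  simp only [Matrix.transpose_apply, Matrix.neg_apply, skewMat_apply]
  rcases lt_trichotomy i j with h | rfl | h
  · simp [h, h.not_gt]
  · simp
  · simp [h, h.not_gt]

theorem skewMat_upperPart {q : ℕ} {M : Matrix (Fin q) (Fin q) ℝ} (hM : M.transpose = -M) :
    skewMat q (upperPart q M).1 = M := by
  ext i j
  have h' : ∀ i j, M j i = -M i j := fun i j => congrFun (congrFun hM i) j
  rw [skewMat_apply]
  rcases lt_trichotomy i j with h | rfl | h
  · simp [h, upperPart_fst]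
  · have := h' i i
    simp only [lt_self_iff_false, dite_false]
    linarith
  · simp [h, h.not_gt, upperPart_fst, h' j i]

/-- For skew `X` one has `v ⬝ᵥ X v = 0`, so `(1 + X) v = 0` forces `v ⬝ᵥ v = 0`. -/
theorem det_one_add_skewMat_ne_zero {q : ℕ} (x : StrictUpper q → ℝ) :
    (1 + skewMat q x).det ≠ 0 := by
  intro h
  obtain ⟨v, hv, hx⟩ := Matrix.exists_mulVec_eq_zero_iff.mpr h
  rw [Matrix.add_mulVec, Matrix.one_mulVec] at hx
  have h1 : v ⬝ᵥ (skewMat q x).mulVec v = -(v ⬝ᵥ (skewMat q x).mulVec v) := by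
    conv_lhs => rw [Matrix.dotProduct_mulVec, ← Matrix.mulVec_transpose, skewMat_transpose,
      Matrix.neg_mulVec, neg_dotProduct, dotProduct_comm]
  have h2 := congrArg (fun w => v ⬝ᵥ w) hx
  simp only [dotProduct_add, dotProduct_zero] at h2
  have h3 : v ⬝ᵥ v = 0 := by linarith
  exact hv (dotProduct_self_eq_zero.mp h3)

/-- The resolvent `(1 + X)⁻¹` of a skew-symmetric matrix `X`. -/
noncomputable def cayleyResolvent {q : ℕ} (x : StrictUpper q → ℝ) : Matrix (Fin q) (Fin q) ℝ :=
  (1 + skewMat q x)⁻¹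

/-- The Cayley transform `(1 - X) (1 + X)⁻¹` of a skew-symmetric matrix `X`. -/
noncomputable def cayley {q : ℕ} (x : StrictUpper q → ℝ) : Matrix (Fin q) (Fin q) ℝ :=
  (2 : ℝ) • cayleyResolvent x - 1

theorem one_add_mul_cayleyResolvent {q : ℕ} (x : StrictUpper q → ℝ) :
    (1 + skewMat q x) * cayleyResolvent x = 1 :=
  Matrix.mul_nonsing_inv _ (isUnit_iff_ne_zero.mpr (det_one_add_skewMat_ne_zero x))

theorem cayleyResolvent_mul_one_add {q : ℕ} (x : StrictUpper q → ℝ) :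
    cayleyResolvent x * (1 + skewMat q x) = 1 :=
  Matrix.nonsing_inv_mul _ (isUnit_iff_ne_zero.mpr (det_one_add_skewMat_ne_zero x))

theorem one_sub_mul_cayleyResolvent_transpose {q : ℕ} (x : StrictUpper q → ℝ) :
    (1 - skewMat q x) * (cayleyResolvent x).transpose = 1 := by
  have := congrArg Matrix.transpose (cayleyResolvent_mul_one_add x)
  rwa [Matrix.transpose_mul, Matrix.transpose_add, Matrix.transpose_one, skewMat_transpose,
    ← sub_eq_add_neg] at this

/-- Insert `2 = (1 - X) + (1 + X)` between `R` and `Rᵀ`; each summand cancels against one of the two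
factors. Orthogonality of the Cayley transform `2R - 1` follows by expansion. -/
theorem two_smul_cayleyResolvent_mul_transpose {q : ℕ} (x : StrictUpper q → ℝ) :
    (2 : ℝ) • (cayleyResolvent x * (cayleyResolvent x).transpose) =
      cayleyResolvent x + (cayleyResolvent x).transpose := by
  calc (2 : ℝ) • (cayleyResolvent x * (cayleyResolvent x).transpose)
      = cayleyResolvent x * ((1 - skewMat q x) * (cayleyResolvent x).transpose) +
        (cayleyResolvent x * (1 + skewMat q x)) * (cayleyResolvent x).transpose := by
        rw [two_smul]; noncomm_ring
    _ = _ := by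
        rw [one_sub_mul_cayleyResolvent_transpose, cayleyResolvent_mul_one_add, Matrix.mul_one,
          Matrix.one_mul]

theorem cayley_transpose {q : ℕ} (x : StrictUpper q → ℝ) :
    (cayley x).transpose = (2 : ℝ) • (cayleyResolvent x).transpose - 1 := by
  simp [cayley]

theorem cayley_mul_transpose {q : ℕ} (x : StrictUpper q → ℝ) :
    cayley x * (cayley x).transpose = 1 := by
  have h := two_smul_cayleyResolvent_mul_transpose x
  rw [two_smul] at h
  have h2 : cayley x * (cayley x).transpose =
      (cayleyResolvent x * (cayleyResolvent x).transpose +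
        cayleyResolvent x * (cayleyResolvent x).transpose) +
      (cayleyResolvent x * (cayleyResolvent x).transpose +
        cayleyResolvent x * (cayleyResolvent x).transpose) -
      (cayleyResolvent x + (cayleyResolvent x).transpose) -
      (cayleyResolvent x + (cayleyResolvent x).transpose) + 1 := by
    rw [cayley_transpose, cayley, two_smul, two_smul]; noncomm_ring
  rw [h2, h]; abel

theorem cayley_transpose_mul {q : ℕ} (x : StrictUpper q → ℝ) :
    (cayley x).transpose * cayley x = 1 :=
  mul_eq_one_comm.mp (cayley_mul_transpose x)

/-- This rewrites the differential `-2 R X R` of the Cayley transform `K` as `K Y` with `Y = -2 Rᵀ X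
R` skew. -/
theorem cayley_mul_cayleyResolvent_transpose {q : ℕ} (x : StrictUpper q → ℝ) :
    cayley x * (cayleyResolvent x).transpose = cayleyResolvent x := by
  rw [cayley, Matrix.sub_mul, Matrix.smul_mul, two_smul_cayleyResolvent_mul_transpose]
  simp

theorem abs_det_cayley {q : ℕ} (x : StrictUpper q → ℝ) : |(cayley x).det| = 1 := by
  have h1 := congrArg Matrix.det (cayley_mul_transpose x)
  rw [Matrix.det_mul, Matrix.det_transpose, Matrix.det_one] at h1
  rcases mul_self_eq_one_iff.mp h1 with h | h <;> simp [h]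

theorem cayley_injective (q : ℕ) :
    Function.Injective (cayley : (StrictUpper q → ℝ) → Matrix (Fin q) (Fin q) ℝ) := by
  intro x y h
  have h1 : cayleyResolvent x = cayleyResolvent y :=
    smul_right_injective _ (two_ne_zero (α := ℝ)) (sub_left_injective h)
  have h2 : 1 + skewMat q x = 1 + skewMat q y := by
    calc 1 + skewMat q x = (1 + skewMat q x) * (cayleyResolvent y * (1 + skewMat q y)) := by
          rw [cayleyResolvent_mul_one_add, Matrix.mul_one]
      _ = (1 + skewMat q x) * cayleyResolvent x * (1 + skewMat q y) := by
          rw [h1, Matrix.mul_assoc]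
      _ = _ := by rw [one_add_mul_cayleyResolvent, Matrix.one_mul]
  have h3 := add_left_cancel h2
  funext ij
  have := congrFun (congrFun h3 ij.1.1) ij.1.2
  simpa [skewMat_apply, show ij.1.1 < ij.1.2 from ij.2] using this

theorem continuous_cayleyResolvent (q : ℕ) :
    Continuous (cayleyResolvent : (StrictUpper q → ℝ) → Matrix (Fin q) (Fin q) ℝ) := by
  have h : (cayleyResolvent : (StrictUpper q → ℝ) → Matrix (Fin q) (Fin q) ℝ) = fun x =>
      ((1 + skewMat q x).det)⁻¹ • (1 + skewMat q x).adjugate := by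
    funext x
    rw [cayleyResolvent, Matrix.inv_def, Ring.inverse_eq_inv']
  have hc : Continuous fun x => 1 + skewMat q x := continuous_const.add (continuous_skewMat q)
  rw [h]
  exact (hc.matrix_det.inv₀ det_one_add_skewMat_ne_zero).smul hc.matrix_adjugate

theorem continuous_cayley (q : ℕ) :
    Continuous (cayley : (StrictUpper q → ℝ) → Matrix (Fin q) (Fin q) ℝ) :=
  ((continuous_cayleyResolvent q).const_smul (2 : ℝ)).sub (continuous_const (y := 1))

/-- An orthogonal matrix without eigenvalue `-1` is a Cayley transform. -/
theorem cayley_inverseCayley {q : ℕ} {O : Matrix (Fin q) (Fin q) ℝ} (hO : O.transpose * O = 1)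
    (hdet : (1 + O).det ≠ 0) :
    cayley (upperPart q ((2 : ℝ) • (1 + O)⁻¹ - 1)).1 = O := by
  have hu := isUnit_iff_ne_zero.mpr hdet
  have hO' : O * O.transpose = 1 := mul_eq_one_comm.mp hO
  set T := (1 + O)⁻¹ with hT
  have h1 : T * (1 + O) = 1 := Matrix.nonsing_inv_mul _ hu
  have h2 : (1 + O) * T = 1 := Matrix.mul_nonsing_inv _ hu
  have h3 : T.transpose = O * T := by
    have h4 : (1 + O.transpose) * (O * T) = 1 := by
      rw [← Matrix.mul_assoc, Matrix.add_mul, Matrix.one_mul, hO, add_comm, h2]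
    have h5 : T.transpose * (1 + O.transpose) = 1 := by
      have := congrArg Matrix.transpose h2
      rwa [Matrix.transpose_mul, Matrix.transpose_add, Matrix.transpose_one] at this
    calc T.transpose = T.transpose * ((1 + O.transpose) * (O * T)) := by rw [h4, Matrix.mul_one]
      _ = O * T := by rw [← Matrix.mul_assoc, h5, Matrix.one_mul]
  have hskew : ((2 : ℝ) • T - 1).transpose = -((2 : ℝ) • T - 1) := by
    have h6 : T.transpose + T = 1 := by rw [h3, ← h2, Matrix.add_mul, Matrix.one_mul, add_comm]
    have h7 : T.transpose = 1 - T := eq_sub_of_add_eq h6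
    rw [Matrix.transpose_sub, Matrix.transpose_smul, Matrix.transpose_one, h7, two_smul, two_smul]
    abel
  rw [cayley, cayleyResolvent, skewMat_upperPart hskew,
    show 1 + ((2 : ℝ) • T - 1) = (2 : ℝ) • T by abel]
  have h8 : ((2 : ℝ) • T)⁻¹ = (2 : ℝ)⁻¹ • (1 + O) := by
    apply Matrix.inv_eq_right_inv
    rw [Matrix.smul_mul, Matrix.mul_smul, h1, smul_smul]
    norm_num
  rw [h8, smul_smul]
  norm_num

end Cayley

/-! ### The spectral parametrisation and its Jacobian. -/

section SpectralMap

/-- The differential of the Cayley transform, pulled back to the Lie algebra and read off above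
the diagonal. -/
noncomputable def cayleyTangent {q : ℕ} (x : StrictUpper q → ℝ) :
    (StrictUpper q → ℝ) →ₗ[ℝ] (StrictUpper q → ℝ) :=
  LinearMap.fst ℝ _ _ ∘ₗ upperPart q ∘ₗ LinearMap.mulRight ℝ (cayleyResolvent x) ∘ₗ
    LinearMap.mulLeft ℝ ((-2 : ℝ) • (cayleyResolvent x).transpose) ∘ₗ skewMat q

theorem cayleyTangent_apply {q : ℕ} (x y : StrictUpper q → ℝ) (ij : StrictUpper q) :
    cayleyTangent x y ij = (((-2 : ℝ) • (cayleyResolvent x).transpose) * skewMat q y *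
      cayleyResolvent x) ij.1.1 ij.1.2 := rfl

/-- The map `(X, λ) ↦ K diag(λ) Kᵀ`, where `K` is the Cayley transform of `X`, in coordinates. -/
noncomputable def spectralMap {q : ℕ} (v : SymCoord q) : SymCoord q :=
  upperPart q (cayley v.1 * Matrix.diagonal v.2 * (cayley v.1).transpose)

theorem symMat_spectralMap {q : ℕ} (v : SymCoord q) :
    symMat q (spectralMap v) = cayley v.1 * Matrix.diagonal v.2 * (cayley v.1).transpose :=
  symMat_upperPart (isHermitian_conj (Matrix.isHermitian_diagonal _) _)

/-- The derivative of `spectralMap`. -/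
noncomputable def spectralDeriv {q : ℕ} (v : SymCoord q) : SymCoord q →ₗ[ℝ] SymCoord q :=
  congruence (cayley v.1) ∘ₗ
    (Matrix.toLin' (Matrix.diagonal fun ij : StrictUpper q => v.2 ij.1.2 - v.2 ij.1.1)).prodMap
      LinearMap.id ∘ₗ (cayleyTangent v.1).prodMap LinearMap.id

/-- Congruence by an orthogonal matrix has determinant of absolute value one, so only the Lie
algebra factor and the eigenvalue gaps remain. That the first depends on `x` alone and the second on
`λ` alone is what makes the integral split. -/
theorem abs_det_spectralDeriv {q : ℕ} (v : SymCoord q) :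
    |LinearMap.det (spectralDeriv v)| = |LinearMap.det (cayleyTangent v.1)| *
      |∏ i, ∏ j ∈ Finset.Ioi i, (v.2 j - v.2 i)| := by
  rw [spectralDeriv, LinearMap.det_comp, LinearMap.det_comp, LinearMap.det_prodMap,
    LinearMap.det_prodMap, det_toLin'_diagonal, det_congruence, abs_mul, abs_pow, abs_det_cayley,
    prod_strictUpper (fun i j => v.2 j - v.2 i)]
  simp [abs_mul, mul_comm]

attribute [local instance] Matrix.linftyOpNormedRing
attribute [local instance] Matrix.linftyOpNormedAlgebra

theorem hasFDerivAt_cayleyResolvent {q : ℕ} (x : StrictUpper q → ℝ) :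
    HasFDerivAt (cayleyResolvent : (StrictUpper q → ℝ) → Matrix (Fin q) (Fin q) ℝ)
      ((-ContinuousLinearMap.mulLeftRight ℝ _ (cayleyResolvent x) (cayleyResolvent x)).comp
        (LinearMap.toContinuousLinearMap (skewMat q))) x := by
  let u : (Matrix (Fin q) (Fin q) ℝ)ˣ := ⟨1 + skewMat q x, cayleyResolvent x,
    one_add_mul_cayleyResolvent x, cayleyResolvent_mul_one_add x⟩
  have h1 : HasFDerivAt (fun x => 1 + skewMat q x) (LinearMap.toContinuousLinearMap (skewMat q)) x :=
    ((LinearMap.toContinuousLinearMap (skewMat q)).hasFDerivAt).const_add 1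
  have h2 := (hasFDerivAt_ringInverse (𝕜 := ℝ) u).comp x h1
  have h3 : (cayleyResolvent : (StrictUpper q → ℝ) → Matrix (Fin q) (Fin q) ℝ) =
      Ring.inverse ∘ fun x => 1 + skewMat q x := by
    funext y
    exact Matrix.nonsing_inv_eq_ringInverse _
  have h4 : HasFDerivAt (cayleyResolvent : (StrictUpper q → ℝ) → Matrix (Fin q) (Fin q) ℝ) _ x :=
    h2.congr_of_eventuallyEq (Filter.Eventually.of_forall (congrFun h3))
  exact h4

/-- With `dK = K Y`, `Y` skew, one gets `d(K Λ Kᵀ) = K (Y Λ - Λ Y + dΛ) Kᵀ`. Above the diagonal the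
bracket has entries `Y i j * (λ j - λ i)`, and on the diagonal it is `dΛ`. -/
theorem hasFDerivAt_spectralMap {q : ℕ} (v : SymCoord q) :
    HasFDerivAt spectralMap (LinearMap.toContinuousLinearMap (spectralDeriv v)) v := by
  have hK : HasFDerivAt (fun v : SymCoord q => cayley v.1)
      ((2 : ℝ) • ((-ContinuousLinearMap.mulLeftRight ℝ _ (cayleyResolvent v.1)
        (cayleyResolvent v.1)).comp (LinearMap.toContinuousLinearMap (skewMat q))).comp
        (ContinuousLinearMap.fst ℝ _ _)) v :=
    (((hasFDerivAt_cayleyResolvent v.1).comp v hasFDerivAt_fst).const_smul (2 : ℝ)).sub_const 1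
  let T : Matrix (Fin q) (Fin q) ℝ →L[ℝ] Matrix (Fin q) (Fin q) ℝ :=
    LinearMap.toContinuousLinearMap
      (Matrix.transposeLinearEquiv (Fin q) (Fin q) ℝ ℝ).toLinearMap
  let D : (Fin q → ℝ) →L[ℝ] Matrix (Fin q) (Fin q) ℝ :=
    LinearMap.toContinuousLinearMap (Matrix.diagonalLinearMap (Fin q) ℝ ℝ)
  have hKt := T.hasFDerivAt.comp v hK
  have hD := (D.comp (ContinuousLinearMap.snd ℝ (StrictUpper q → ℝ) (Fin q → ℝ))).hasFDerivAt (x := v)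
  have hall := (LinearMap.toContinuousLinearMap (upperPart q)).hasFDerivAt.comp v
    ((hK.mul' hD).mul' hKt)
  refine hall.congr_fderiv ?_
  refine ContinuousLinearMap.ext fun w => ?_
  set K := cayley v.1 with hKdef
  set R := cayleyResolvent v.1 with hR
  set Λ := Matrix.diagonal v.2 with hΛ
  set X := skewMat q w.1 with hX
  set Y := ((-2 : ℝ) • R.transpose) * X * R with hY
  have hYt : Y.transpose = -Y := by
    rw [hY, Matrix.transpose_mul, Matrix.transpose_mul, Matrix.transpose_smul,
      Matrix.transpose_transpose, hX, skewMat_transpose]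
    simp [Matrix.mul_assoc]
  have hKY : K * Y = (2 : ℝ) • -(R * X * R) := by
    rw [hY, ← Matrix.mul_assoc, ← Matrix.mul_assoc, Matrix.mul_smul,
      cayley_mul_cayleyResolvent_transpose]
    simp [hR]
  set M := Y * Λ - Λ * Y + Matrix.diagonal w.2 with hM
  have hMh : M.IsHermitian := by
    show M.transpose = M
    rw [hM, Matrix.transpose_add, Matrix.transpose_sub, Matrix.transpose_mul Y, Matrix.transpose_mul Λ,
      hYt, hΛ, Matrix.diagonal_transpose, Matrix.diagonal_transpose]
    simp only [Matrix.mul_neg, Matrix.neg_mul]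
    abel
  have hup : ((Matrix.toLin' (Matrix.diagonal fun ij : StrictUpper q =>
      v.2 ij.1.2 - v.2 ij.1.1)).prodMap LinearMap.id)
      (((cayleyTangent v.1).prodMap LinearMap.id) w) = upperPart q M := by
    refine Prod.ext (funext fun ij => ?_) (funext fun i => ?_)
    · simp only [LinearMap.prodMap_apply, Matrix.toLin'_apply, Matrix.mulVec_diagonal,
        upperPart_fst, cayleyTangent_apply, hM, Matrix.add_apply, Matrix.sub_apply, hΛ,
        Matrix.mul_diagonal, Matrix.diagonal_mul, Matrix.diagonal_apply_ne _ ij.2.ne]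
      rw [← hR, ← hX, ← hY]
      ring
    · simp only [LinearMap.prodMap_apply, upperPart_snd, hM, Matrix.add_apply, Matrix.sub_apply,
        hΛ, Matrix.mul_diagonal, Matrix.diagonal_mul, Matrix.diagonal_apply_eq, LinearMap.id_apply]
      ring
  have hrhs : spectralDeriv v w = upperPart q (K * M * K.transpose) := by
    rw [spectralDeriv, LinearMap.comp_apply, LinearMap.comp_apply, hup, congruence_apply,
      symMat_upperPart hMh]
  have hlhs : K * M * K.transpose = K * Λ * ((2 : ℝ) • -(R * X * R)).transpose +
      (K * Matrix.diagonal w.2 + (2 : ℝ) • -(R * X * R) * Λ) * K.transpose := by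
    rw [← hKY, Matrix.transpose_mul, hYt, hM]
    noncomm_ring
  change _ = spectralDeriv v w
  rw [hrhs, hlhs]
  rfl

theorem continuous_spectralMap (q : ℕ) : Continuous (spectralMap : SymCoord q → SymCoord q) :=
  continuous_iff_continuousAt.mpr fun v => (hasFDerivAt_spectralMap v).continuousAt

theorem continuous_det_cayleyTangent (q : ℕ) :
    Continuous fun x : StrictUpper q → ℝ => LinearMap.det (cayleyTangent x) := by
  simp_rw [← LinearMap.det_toMatrix']
  refine Continuous.matrix_det ?_
  refine continuous_matrix fun a b => ?_
  simp_rw [LinearMap.toMatrix'_apply, cayleyTangent_apply]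
  have := continuous_cayleyResolvent q
  refine Continuous.matrix_elem (Continuous.matrix_mul (Continuous.matrix_mul ?_ continuous_const)
    this) _ _
  exact this.matrix_transpose.const_smul (-2 : ℝ)

end SpectralMap

/-! ### Averaging over conjugation by Haar-distributed orthogonal matrices. -/

section Averaging

/-- The normalised Haar measure of the orthogonal group. -/
noncomputable abbrev haarOrthogonal (q : ℕ) : Measure (Matrix.orthogonalGroup (Fin q) ℝ) :=
  Measure.haarMeasure (⊤ : TopologicalSpace.PositiveCompacts (Matrix.orthogonalGroup (Fin q) ℝ))

instance isProbabilityMeasure_haarOrthogonal (q : ℕ) :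
    IsProbabilityMeasure (haarOrthogonal q) :=
  ⟨Measure.haarMeasure_self⟩

theorem continuous_conj_orthogonal (q : ℕ) :
    Continuous fun x : Matrix (Fin q) (Fin q) ℝ × Matrix.orthogonalGroup (Fin q) ℝ =>
      (x.2 : Matrix (Fin q) (Fin q) ℝ).transpose * x.1 * (x.2 : Matrix (Fin q) (Fin q) ℝ) := by
  have h : Continuous fun x : Matrix (Fin q) (Fin q) ℝ × Matrix.orthogonalGroup (Fin q) ℝ =>
    (x.2 : Matrix (Fin q) (Fin q) ℝ) := continuous_subtype_val.comp continuous_snd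
  exact (h.matrix_transpose.matrix_mul continuous_fst).matrix_mul h

instance secondCountableTopology_matrix (q : ℕ) :
    SecondCountableTopology (Matrix (Fin q) (Fin q) ℝ) :=
  inferInstanceAs (SecondCountableTopology (Fin q → Fin q → ℝ))

/-- Write the Haar measure as an integral of an indicator and swap the integrals. For fixed `O`, the
substitution `S ↦ O S Oᵀ` preserves `lebSym` and `φ`, and turns the condition into `S ∈ W`,
independently of `O`. Invariance of `φ` is needed only on Hermitian matrices, which carry `lebSym`.
-/
theorem lintegral_mul_haar_conj_mem {q : ℕ} {φ : Matrix (Fin q) (Fin q) ℝ → ℝ≥0∞}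
    (hφ : Measurable φ)
    (hinv : ∀ (O : Matrix.orthogonalGroup (Fin q) ℝ) (S : Matrix (Fin q) (Fin q) ℝ),
      S.IsHermitian → φ (O * S * (O : Matrix (Fin q) (Fin q) ℝ).transpose) = φ S)
    {W : Set (Matrix (Fin q) (Fin q) ℝ)} (hW : MeasurableSet W) :
    ∫⁻ S, φ S * haarOrthogonal q {O | (O : Matrix (Fin q) (Fin q) ℝ).transpose * S *
      (O : Matrix (Fin q) (Fin q) ℝ) ∈ W} ∂(lebSym q) = ∫⁻ S in W, φ S ∂(lebSym q) := by
  have hc := (continuous_conj_orthogonal q).measurable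
  have hind : Measurable (W.indicator (1 : Matrix (Fin q) (Fin q) ℝ → ℝ≥0∞)) :=
    measurable_one.indicator hW
  have h1 : ∀ S, φ S * haarOrthogonal q {O | (O : Matrix (Fin q) (Fin q) ℝ).transpose * S *
      (O : Matrix (Fin q) (Fin q) ℝ) ∈ W} =
      ∫⁻ O, φ S * W.indicator 1 ((O : Matrix (Fin q) (Fin q) ℝ).transpose * S *
        (O : Matrix (Fin q) (Fin q) ℝ)) ∂(haarOrthogonal q) := by
    intro S
    have hm : Measurable fun O : Matrix.orthogonalGroup (Fin q) ℝ =>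
        (O : Matrix (Fin q) (Fin q) ℝ).transpose * S * (O : Matrix (Fin q) (Fin q) ℝ) :=
      ((continuous_subtype_val.matrix_transpose.matrix_mul continuous_const).matrix_mul
        continuous_subtype_val).measurable
    have h := lintegral_const_mul (μ := haarOrthogonal q) (φ S) (hind.comp hm)
    have h' := lintegral_indicator_one (μ := haarOrthogonal q) (hm hW)
    exact (congrArg (φ S * ·) h'.symm).trans h.symm
  simp_rw [h1]
  rw [lintegral_lintegral_swap]
  · have h2 : ∀ O : Matrix.orthogonalGroup (Fin q) ℝ,
        ∫⁻ S, φ S * W.indicator 1 ((O : Matrix (Fin q) (Fin q) ℝ).transpose * S *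
          (O : Matrix (Fin q) (Fin q) ℝ)) ∂(lebSym q) = ∫⁻ S in W, φ S ∂(lebSym q) := by
      intro O
      have hm : Measurable fun S : Matrix (Fin q) (Fin q) ℝ =>
          (O : Matrix (Fin q) (Fin q) ℝ).transpose * S * (O : Matrix (Fin q) (Fin q) ℝ) :=
        ((continuous_const.matrix_mul continuous_id).matrix_mul continuous_const).measurable
      refine (lintegral_lebSym_conj_orthogonal O (hφ.mul (hind.comp hm))).symm.trans ?_
      rw [← lintegral_indicator hW]
      refine lintegral_congr_ae ?_
      filter_upwards [ae_lebSym_isHermitian q] with S hS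
      rw [Pi.mul_apply, hinv O S hS, Function.comp_apply,
        show (O : Matrix (Fin q) (Fin q) ℝ).transpose *
          ((O : Matrix (Fin q) (Fin q) ℝ) * S * (O : Matrix (Fin q) (Fin q) ℝ).transpose) *
          (O : Matrix (Fin q) (Fin q) ℝ) =
          ((O : Matrix (Fin q) (Fin q) ℝ).transpose * (O : Matrix (Fin q) (Fin q) ℝ)) * S *
          ((O : Matrix (Fin q) (Fin q) ℝ).transpose * (O : Matrix (Fin q) (Fin q) ℝ)) by
          simp only [Matrix.mul_assoc], orthogonal_transpose_mul, Matrix.one_mul, Matrix.mul_one]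
      by_cases h : S ∈ W <;> simp [h]
    simp_rw [h2]
    simp
  · exact ((hφ.comp measurable_fst).mul (hind.comp hc)).aemeasurable

/-- The symmetric matrices with coordinates in a given set. -/
def symSet {q : ℕ} (t : Set (SymCoord q)) : Set (Matrix (Fin q) (Fin q) ℝ) :=
  {S | S.IsHermitian ∧ upperPart q S ∈ t}

theorem measurableSet_symSet {q : ℕ} {t : Set (SymCoord q)} (ht : MeasurableSet t) :
    MeasurableSet (symSet t) :=
  (isClosed_isHermitian q).measurableSet.inter ((continuous_upperPart q).measurable ht)

theorem symMat_mem_symSet {q : ℕ} {t : Set (SymCoord q)} (v : SymCoord q) :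
    symMat q v ∈ symSet t ↔ v ∈ t := by
  rw [symSet, Set.mem_ofPred_eq, upperPart_symMat]
  exact and_iff_right (symMat_isHermitian v)

theorem mem_symSet_image {q : ℕ} {s : Set (SymCoord q)} {S : Matrix (Fin q) (Fin q) ℝ} :
    S ∈ symSet (spectralMap '' s) ↔
      ∃ v ∈ s, S = cayley v.1 * Matrix.diagonal v.2 * (cayley v.1).transpose := by
  constructor
  · rintro ⟨hS, v, hv, h⟩
    exact ⟨v, hv, by rw [← symMat_spectralMap, h, symMat_upperPart hS]⟩
  · rintro ⟨v, hv, rfl⟩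
    exact ⟨isHermitian_conj (Matrix.isHermitian_diagonal _) _, v, hv, rfl⟩

theorem exists_lintegral_symSet (q : ℕ) : ∃ k : ℝ≥0∞, k ≠ 0 ∧ k ≠ ∞ ∧
    ∀ (t : Set (SymCoord q)), MeasurableSet t → ∀ φ : Matrix (Fin q) (Fin q) ℝ → ℝ≥0∞,
      Measurable φ → ∫⁻ S in symSet t, φ S ∂(lebSym q) = k * ∫⁻ v in t, φ (symMat q v) := by
  obtain ⟨k, hk0, hkt, hk⟩ := exists_lebSym_eq_smul_map q
  refine ⟨k, hk0, hkt, fun t ht φ hφ => ?_⟩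
  have hpre : symMat q ⁻¹' symSet t = t := Set.ext symMat_mem_symSet
  rw [hk, Measure.restrict_smul, lintegral_smul_measure, smul_eq_mul,
    setLIntegral_map (measurableSet_symSet ht) hφ (continuous_symMat q).measurable, hpre]

theorem lebSym_symSet_eq_zero {q : ℕ} {t : Set (SymCoord q)} (ht : MeasurableSet t)
    (h0 : volume t = 0) : lebSym q (symSet t) = 0 := by
  obtain ⟨k, -, -, hk⟩ := exists_lintegral_symSet q
  have := hk t ht 1 measurable_one
  simpa [h0] using this

end Averaging

/-! ### A Cayley neighbourhood on which the spectral parametrisation is injective. -/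

section SpectralChart

theorem exists_isOpen_of_eventually_nhds_prod {α : Type*} [TopologicalSpace α] {a : α}
    {P : α → α → Prop} (h : ∀ᶠ p in nhds (a, a), P p.1 p.2) :
    ∃ U : Set α, IsOpen U ∧ a ∈ U ∧ ∀ x ∈ U, ∀ y ∈ U, P x y := by
  obtain ⟨U, V, hU, hUa, hV, hVa, hUV⟩ := mem_nhds_prod_iff'.mp h
  exact ⟨U ∩ V, hU.inter hV, ⟨hUa, hVa⟩, fun x hx y hy => hUV (Set.mk_mem_prod hx.1 hy.2)⟩

/-- At `x = y = 0` the product is the identity, and positivity of the diagonal is an open condition.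
It will exclude the sign ambiguity of eigenvectors. -/
theorem exists_isOpen_cayley_chart (q : ℕ) : ∃ U : Set (StrictUpper q → ℝ), IsOpen U ∧ 0 ∈ U ∧
    ∀ x ∈ U, ∀ y ∈ U, ∀ i, 0 < ((cayley x).transpose * cayley y) i i := by
  have hc : Continuous fun p : (StrictUpper q → ℝ) × (StrictUpper q → ℝ) =>
      (cayley p.1).transpose * cayley p.2 :=
    ((continuous_cayley q).comp continuous_fst).matrix_transpose.matrix_mul
      ((continuous_cayley q).comp continuous_snd)
  refine exists_isOpen_of_eventually_nhds_prod
    (P := fun x y => ∀ i, 0 < ((cayley x).transpose * cayley y) i i) ?_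
  refine Filter.eventually_all.mpr fun i => ?_
  have h0 : 0 < ((cayley (0 : StrictUpper q → ℝ)).transpose *
      cayley (0 : StrictUpper q → ℝ)) i i := by
    rw [cayley_transpose_mul, Matrix.one_apply_eq]
    exact one_pos
  have h1 : Continuous fun p : (StrictUpper q → ℝ) × (StrictUpper q → ℝ) =>
    ((cayley p.1).transpose * cayley p.2) i i := hc.matrix_elem i i
  exact continuousAt_const.eventually_lt h1.continuousAt h0

theorem eq_diagonal_of_commute_diagonal {q : ℕ} {l : Fin q → ℝ} (hl : Function.Injective l)
    {Z : Matrix (Fin q) (Fin q) ℝ} (h : Z * Matrix.diagonal l = Matrix.diagonal l * Z) :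
    Z = Matrix.diagonal fun i => Z i i := by
  ext i j
  by_cases hij : i = j
  · subst hij; simp
  · rw [Matrix.diagonal_apply_ne _ hij]
    have := congrFun (congrFun h i) j
    rw [Matrix.mul_diagonal, Matrix.diagonal_mul] at this
    have h2 : Z i j * (l j - l i) = 0 := by linarith
    exact (mul_eq_zero.mp h2).resolve_right (sub_ne_zero.mpr fun h => hij (hl h).symm)

/-- The eigenvalues agree because both vectors are sorted. Then `Z = K(x)ᵀ K(y)` commutes with a
diagonal matrix with distinct entries, so it is diagonal and orthogonal with entries `±1`; the
positivity required of `U` leaves only `Z = 1`. -/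
theorem injOn_spectralMap {q : ℕ} {U : Set (StrictUpper q → ℝ)}
    (hU : ∀ x ∈ U, ∀ y ∈ U, ∀ i, 0 < ((cayley x).transpose * cayley y) i i) :
    Set.InjOn (spectralMap : SymCoord q → SymCoord q) (U ×ˢ {l | StrictMono l}) := by
  rintro ⟨x, l⟩ ⟨hx, hl⟩ ⟨y, m⟩ ⟨hy, hm⟩ h
  have h1 := congrArg (symMat q) h
  rw [symMat_spectralMap, symMat_spectralMap] at h1
  simp only at hx hl hy hm h1
  change StrictMono l at hl
  change StrictMono m at hm
  have hlm : l = m := by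
    rw [← orderedEigenvalues_conj_diagonal hl.monotone (cayley_transpose_mul x), h1,
      orderedEigenvalues_conj_diagonal hm.monotone (cayley_transpose_mul y)]
  subst hlm
  set Z := (cayley x).transpose * cayley y with hZ
  have hcomm : Z * Matrix.diagonal l = Matrix.diagonal l * Z := by
    calc Z * Matrix.diagonal l
        = (cayley x).transpose * (cayley y * Matrix.diagonal l * (cayley y).transpose) *
            cayley y := by
          simp only [hZ, Matrix.mul_assoc, cayley_transpose_mul, Matrix.mul_one]
      _ = ((cayley x).transpose * cayley x) * Matrix.diagonal l * Z := by
          rw [← h1]; simp only [hZ, Matrix.mul_assoc]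
      _ = _ := by rw [cayley_transpose_mul, Matrix.one_mul]
  have hdiag := eq_diagonal_of_commute_diagonal hl.injective hcomm
  have hZZ : Z * Z.transpose = 1 := by
    rw [hZ, Matrix.transpose_mul, Matrix.transpose_transpose, Matrix.mul_assoc,
      ← Matrix.mul_assoc (cayley y), cayley_mul_transpose, Matrix.one_mul, cayley_transpose_mul]
  have hone : Z = 1 := by
    rw [hdiag, ← Matrix.diagonal_one]
    congr 1
    funext i
    have h2 : (Z * Z.transpose) i i = 1 := by rw [hZZ]; simp
    rw [hdiag, Matrix.diagonal_transpose, Matrix.diagonal_mul_diagonal,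
      Matrix.diagonal_apply_eq] at h2
    have h3 := hU x hx y hy i
    rw [← hZ] at h3
    nlinarith
  have hxy : cayley x = cayley y := by
    calc cayley x = cayley x * Z := by rw [hone, Matrix.mul_one]
      _ = cayley y := by rw [hZ, ← Matrix.mul_assoc, cayley_mul_transpose, Matrix.one_mul]
  rw [cayley_injective q hxy]

/-- The inverse Cayley transform is continuous at the identity and sends it to `0`. The result gives
the chart positive Haar measure; the transpose appears because the averaging uses `Oᵀ S O`. -/
theorem cayley_chart_mem_nhds {q : ℕ} {U : Set (StrictUpper q → ℝ)} (hU : IsOpen U)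
    (h0 : 0 ∈ U) : {O : Matrix.orthogonalGroup (Fin q) ℝ | ∃ x ∈ U,
      cayley x = (O : Matrix (Fin q) (Fin q) ℝ).transpose} ∈ nhds 1 := by
  have hT : Continuous fun O : Matrix.orthogonalGroup (Fin q) ℝ =>
      1 + (O : Matrix (Fin q) (Fin q) ℝ).transpose :=
    continuous_const.add continuous_subtype_val.matrix_transpose
  have hone : ((1 : Matrix.orthogonalGroup (Fin q) ℝ) : Matrix (Fin q) (Fin q) ℝ).transpose = 1 :=
    Matrix.transpose_one
  have hdet1 : (1 + ((1 : Matrix.orthogonalGroup (Fin q) ℝ) :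
      Matrix (Fin q) (Fin q) ℝ).transpose).det ≠ 0 := by
    rw [hone, ← two_smul ℝ, Matrix.det_smul, Matrix.det_one]
    simp
  have hdet : ∀ᶠ O : Matrix.orthogonalGroup (Fin q) ℝ in nhds 1,
      (1 + (O : Matrix (Fin q) (Fin q) ℝ).transpose).det ≠ 0 :=
    hT.matrix_det.continuousAt.eventually_ne hdet1
  have hinv : ContinuousAt (fun O : Matrix.orthogonalGroup (Fin q) ℝ =>
      (1 + (O : Matrix (Fin q) (Fin q) ℝ).transpose)⁻¹) 1 := by
    simp_rw [Matrix.inv_def, Ring.inverse_eq_inv']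
    exact (hT.matrix_det.continuousAt.inv₀ hdet1).smul hT.matrix_adjugate.continuousAt
  have hx : ContinuousAt (fun O : Matrix.orthogonalGroup (Fin q) ℝ =>
      (upperPart q ((2 : ℝ) • (1 + (O : Matrix (Fin q) (Fin q) ℝ).transpose)⁻¹ - 1)).1) 1 :=
    (continuous_fst.comp (continuous_upperPart q)).continuousAt.comp
      ((hinv.const_smul (2 : ℝ)).sub continuousAt_const)
  have hmem : ∀ᶠ O : Matrix.orthogonalGroup (Fin q) ℝ in nhds 1,
      (upperPart q ((2 : ℝ) • (1 + (O : Matrix (Fin q) (Fin q) ℝ).transpose)⁻¹ - 1)).1 ∈ U := by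
    refine hx.eventually_mem (hU.mem_nhds ?_)
    have h2 : (1 + (1 : Matrix (Fin q) (Fin q) ℝ))⁻¹ = (2 : ℝ)⁻¹ • 1 := by
      apply Matrix.inv_eq_right_inv
      rw [← two_smul ℝ, Matrix.smul_mul, Matrix.mul_smul, smul_smul]
      simp
    rw [hone, h2, smul_smul]
    simpa using h0
  filter_upwards [hdet, hmem] with O h1 h2
  refine ⟨_, h2, cayley_inverseCayley ?_ h1⟩
  rw [Matrix.transpose_transpose]
  exact orthogonal_mul_transpose O

/-- Membership in the chart depends on `O` and not on the simple spectrum: if `Oᵀ diag(l) O = K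
diag(l) Kᵀ`, then `O K` commutes with `diag(l)`, hence is diagonal, hence commutes with `diag(m)`
too. -/
theorem conj_mem_symSet_of_strictMono {q : ℕ} {U : Set (StrictUpper q → ℝ)} {l m : Fin q → ℝ}
    (hl : StrictMono l) (hm : StrictMono m) (O : Matrix.orthogonalGroup (Fin q) ℝ)
    (h : (O : Matrix (Fin q) (Fin q) ℝ).transpose * Matrix.diagonal l *
      (O : Matrix (Fin q) (Fin q) ℝ) ∈ symSet (spectralMap '' (U ×ˢ {l | StrictMono l}))) :
    (O : Matrix (Fin q) (Fin q) ℝ).transpose * Matrix.diagonal m *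
      (O : Matrix (Fin q) (Fin q) ℝ) ∈ symSet (spectralMap '' (U ×ˢ {l | StrictMono l})) := by
  rw [mem_symSet_image] at h ⊢
  obtain ⟨⟨x, l'⟩, ⟨hx, hl'⟩, h⟩ := h
  simp only at hx h
  change StrictMono l' at hl'
  have hll : l = l' := by
    rw [← orderedEigenvalues_conj_diagonal hl'.monotone (cayley_transpose_mul x), ← h]
    have := orderedEigenvalues_conj_diagonal hl.monotone
      (O := (O : Matrix (Fin q) (Fin q) ℝ).transpose)
      (by rw [Matrix.transpose_transpose]; exact orthogonal_mul_transpose O)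
    rw [Matrix.transpose_transpose] at this
    exact this.symm
  subst hll
  refine ⟨(x, m), ⟨hx, hm⟩, ?_⟩
  set Q := (O : Matrix (Fin q) (Fin q) ℝ) with hQ
  set Z := Q * cayley x with hZ
  have hcomm : Z * Matrix.diagonal l = Matrix.diagonal l * Z := by
    calc Z * Matrix.diagonal l
        = Q * (cayley x * Matrix.diagonal l * (cayley x).transpose) * cayley x := by
          simp only [hZ, Matrix.mul_assoc, cayley_transpose_mul, Matrix.mul_one]
      _ = (Q * Q.transpose) * Matrix.diagonal l * Z := by
          rw [← h]; simp only [hZ, Matrix.mul_assoc]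
      _ = _ := by rw [hQ, orthogonal_mul_transpose, Matrix.one_mul]
  have hdiag := eq_diagonal_of_commute_diagonal hl.injective hcomm
  have hcomm' : Z * Matrix.diagonal m = Matrix.diagonal m * Z := by
    rw [hdiag, Matrix.diagonal_mul_diagonal, Matrix.diagonal_mul_diagonal]
    simp_rw [mul_comm]
  calc Q.transpose * Matrix.diagonal m * Q
      = Q.transpose * (Matrix.diagonal m * Z) * (cayley x).transpose := by
        simp only [hZ, Matrix.mul_assoc, cayley_mul_transpose, Matrix.mul_one]
    _ = (Q.transpose * Q) * cayley x * Matrix.diagonal m * (cayley x).transpose := by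
        rw [← hcomm']; simp only [hZ, Matrix.mul_assoc]
    _ = _ := by rw [hQ, orthogonal_transpose_mul, Matrix.one_mul]

end SpectralChart

/-! ### Weyl's integration formula. -/

section WeylIntegration

/-- The Vandermonde product. -/
def vandermondeProd {q : ℕ} (l : Fin q → ℝ) : ℝ := ∏ i, ∏ j ∈ Finset.Ioi i, (l j - l i)

theorem continuous_vandermondeProd (q : ℕ) :
    Continuous (vandermondeProd : (Fin q → ℝ) → ℝ) := by
  unfold vandermondeProd
  fun_prop

theorem vandermondeProd_nonneg {q : ℕ} {l : Fin q → ℝ} (hl : Monotone l) :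
    0 ≤ vandermondeProd l :=
  Finset.prod_nonneg fun _ _ => Finset.prod_nonneg fun _ hj =>
    sub_nonneg.mpr (hl (Finset.mem_Ioi.mp hj).le)

theorem vandermondeProd_pos {q : ℕ} {l : Fin q → ℝ} (hl : StrictMono l) :
    0 < vandermondeProd l :=
  Finset.prod_pos fun _ _ => Finset.prod_pos fun _ hj =>
    sub_pos.mpr (hl (Finset.mem_Ioi.mp hj))

theorem strictMono_of_vandermondeProd_ne_zero {q : ℕ} {l : Fin q → ℝ} (hl : Monotone l)
    (h : vandermondeProd l ≠ 0) : StrictMono l := by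
  intro i j hij
  refine lt_of_le_of_ne (hl hij.le) fun heq => h ?_
  refine Finset.prod_eq_zero (Finset.mem_univ i)
    (Finset.prod_eq_zero (Finset.mem_Ioi.mpr hij) ?_)
  rw [heq, sub_self]

theorem isOpen_strictMono (q : ℕ) : IsOpen {l : Fin q → ℝ | StrictMono l} := by
  have : {l : Fin q → ℝ | StrictMono l} = ⋂ (i) (j) (_ : i < j), {l | l i < l j} := by
    ext l; simp [StrictMono]
  rw [this]
  exact isOpen_iInter_of_finite fun i => isOpen_iInter_of_finite fun j =>
    isOpen_iInter_of_finite fun _ => isOpen_lt (by fun_prop) (by fun_prop)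

theorem continuousLinearMap_det_spectralDeriv {q : ℕ} (v : SymCoord q) :
    |(LinearMap.toContinuousLinearMap (spectralDeriv v)).det| =
      |LinearMap.det (cayleyTangent v.1)| * |vandermondeProd v.2| :=
  abs_det_spectralDeriv v

/-- On the set where the Vandermonde product vanishes, the Jacobian of `spectralMap` is zero, so its
image is null (Sard). By averaging, for almost every `S` the set of `O` with `Oᵀ S O` in that image
is Haar-null. If `S` had a repeated eigenvalue, this set would contain a neighbourhood of a
diagonalising `Q`, a contradiction. -/
theorem ae_strictMono_orderedEigenvalues (q : ℕ) :
    ∀ᵐ S ∂(lebSym q), StrictMono (orderedEigenvalues q S) := by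
  obtain ⟨U, hU, h0, -⟩ := exists_isOpen_cayley_chart q
  set s : Set (SymCoord q) := U ×ˢ {l | vandermondeProd l = 0} with hs
  have hnull : volume (spectralMap '' s) = 0 := by
    refine addHaar_image_eq_zero_of_det_fderivWithin_eq_zero volume
      (fun v _ => (hasFDerivAt_spectralMap v).hasFDerivWithinAt) fun v hv => ?_
    have h1 : vandermondeProd v.2 = 0 := hv.2
    rw [← abs_eq_zero, continuousLinearMap_det_spectralDeriv, h1]
    simp
  -- The critical image is not known to be measurable, so a measurable null hull replaces it.
  set t := toMeasurable volume (spectralMap '' s) with ht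
  have htm : MeasurableSet t := measurableSet_toMeasurable _ _
  have ht0 : volume t = 0 := (measure_toMeasurable _).trans hnull
  have havg := lintegral_mul_haar_conj_mem (q := q) (φ := 1) measurable_one
    (fun _ _ _ => rfl) (measurableSet_symSet htm)
  rw [setLIntegral_measure_zero _ _ (lebSym_symSet_eq_zero htm ht0)] at havg
  have hmeas : Measurable fun S => (1 : Matrix (Fin q) (Fin q) ℝ → ℝ≥0∞) S * haarOrthogonal q
      {O | (O : Matrix (Fin q) (Fin q) ℝ).transpose * S *
        (O : Matrix (Fin q) (Fin q) ℝ) ∈ symSet t} :=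
    measurable_one.mul (measurable_measure_prodMk_left
      ((continuous_conj_orthogonal q).measurable (measurableSet_symSet htm)))
  have hae := (lintegral_eq_zero_iff hmeas).mp havg
  filter_upwards [hae, ae_lebSym_isHermitian q] with S hS hSh
  refine strictMono_of_vandermondeProd_ne_zero (orderedEigenvalues_monotone q S) fun hV => ?_
  obtain ⟨Q, hQ⟩ := exists_orthogonal_diagonalization hSh
  rw [Pi.one_apply, one_mul, Pi.zero_apply] at hS
  have hcont : Filter.Tendsto (fun O : Matrix.orthogonalGroup (Fin q) ℝ => Q⁻¹ * O) (nhds Q)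
      (nhds 1) := by
    have : Continuous fun O : Matrix.orthogonalGroup (Fin q) ℝ => Q⁻¹ * O :=
      continuous_const.mul continuous_id
    simpa using this.tendsto Q
  have hnhds := hcont (cayley_chart_mem_nhds hU h0)
  have hpos := Measure.measure_pos_of_mem_nhds (haarOrthogonal q) hnhds
  refine hpos.ne' (measure_mono_null ?_ hS)
  rintro O ⟨x, hx, hxO⟩
  have hxO' : cayley x = (O : Matrix (Fin q) (Fin q) ℝ).transpose *
      (Q : Matrix (Fin q) (Fin q) ℝ) := by
    rw [hxO]
    change (((Q : Matrix (Fin q) (Fin q) ℝ).transpose) * _).transpose = _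
    rw [Matrix.transpose_mul, Matrix.transpose_transpose]
  have hmem : (O : Matrix (Fin q) (Fin q) ℝ).transpose * S * (O : Matrix (Fin q) (Fin q) ℝ) ∈
      symSet (spectralMap '' s) := by
    rw [mem_symSet_image]
    refine ⟨(x, orderedEigenvalues q S), ⟨hx, hV⟩, ?_⟩
    simp only [hxO', Matrix.transpose_mul, Matrix.transpose_transpose]
    conv_lhs => rw [hQ]
    simp only [Matrix.mul_assoc]
  exact ⟨hmem.1, subset_toMeasurable _ _ hmem.2⟩

/-- Each entry is a sum of `q` terms `O i k * λ k * O j k` of absolute value at most one, so the set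
lies in a ball of the coordinate space. -/
theorem lebSym_eigenvalues_Ioo_lt_top (q : ℕ) :
    lebSym q {S | S.IsHermitian ∧ ∀ i, orderedEigenvalues q S i ∈ Set.Ioo (0 : ℝ) 1} < ∞ := by
  obtain ⟨k, -, hkt, hk⟩ := exists_lintegral_symSet q
  have hb := hk (Metric.closedBall 0 q) measurableSet_closedBall 1 measurable_one
  simp only [Pi.one_apply, setLIntegral_one] at hb
  refine (measure_mono ?_).trans_lt (hb.trans_lt
    (ENNReal.mul_lt_top hkt.lt_top measure_closedBall_lt_top))
  rintro S ⟨hS, hl⟩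
  refine ⟨hS, ?_⟩
  have hentry : ∀ i j, |S i j| ≤ q := by
    intro i j
    obtain ⟨O, hO⟩ := exists_orthogonal_diagonalization hS
    have h1 : S i j = ∑ k, (O : Matrix (Fin q) (Fin q) ℝ) i k * orderedEigenvalues q S k *
        (O : Matrix (Fin q) (Fin q) ℝ) j k := by
      conv_lhs => rw [hO]
      rw [Matrix.mul_apply]
      simp [Matrix.mul_diagonal]
    rw [h1]
    refine (Finset.abs_sum_le_sum_abs _ _).trans ?_
    refine (Finset.sum_le_card_nsmul _ _ 1 fun k _ => ?_).trans (by simp)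
    have ha : ∀ a b, |(O : Matrix (Fin q) (Fin q) ℝ) a b| ≤ 1 :=
      fun a b => entry_norm_bound_of_unitary O.2 a b
    have hk := hl k
    rw [abs_mul, abs_mul]
    refine mul_le_one₀ (mul_le_one₀ (ha i k) (abs_nonneg _) ?_) (abs_nonneg _) (ha j k)
    rw [abs_of_pos hk.1]; exact hk.2.le
  rw [mem_closedBall_zero_iff, Prod.norm_def, max_le_iff]
  exact ⟨(pi_norm_le_iff_of_nonneg (Nat.cast_nonneg q)).mpr fun ij => hentry _ _,
    (pi_norm_le_iff_of_nonneg (Nat.cast_nonneg q)).mpr fun i => hentry i i⟩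

theorem exists_strictMono_Ioo (q : ℕ) :
    ∃ l : Fin q → ℝ, StrictMono l ∧ ∀ i, l i ∈ Set.Ioo (0 : ℝ) 1 := by
  refine ⟨fun i => ((i : ℕ) + 1 : ℝ) / (q + 1), fun i j hij => ?_, fun i => ⟨by positivity, ?_⟩⟩
  · have : ((i : ℕ) : ℝ) < (j : ℕ) := by exact_mod_cast hij
    dsimp only
    gcongr
  · rw [div_lt_one (by positivity)]
    have : ((i : ℕ) : ℝ) < q := by exact_mod_cast i.2
    linarith

/-- The strictly increasing vectors in `t` form a nonempty open set on which the integrand is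
nonzero. -/
theorem lintegral_strictMono_pos {q : ℕ} {g : (Fin q → ℝ) → ℝ≥0∞} {t : Set (Fin q → ℝ)}
    (ht : IsOpen t) (hg : Measurable g) (hpos : ∀ l ∈ t, StrictMono l → g l ≠ 0)
    (hne : ∃ l ∈ t, StrictMono l) :
    ∫⁻ l in {l : Fin q → ℝ | StrictMono l}, ENNReal.ofReal (vandermondeProd l) * g l ≠ 0 := by
  have hm : Measurable fun l : Fin q → ℝ => ENNReal.ofReal (vandermondeProd l) * g l :=
    (continuous_vandermondeProd q).measurable.ennreal_ofReal.mul hg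
  intro h0
  rw [lintegral_eq_zero_iff hm, Filter.EventuallyEq,
    ae_restrict_iff' (isOpen_strictMono q).measurableSet] at h0
  obtain ⟨l, hlt, hl⟩ := hne
  have hpos' := ((isOpen_strictMono q).inter ht).measure_pos volume ⟨l, hl, hlt⟩
  refine hpos'.ne' (measure_mono_null ?_ h0)
  rintro m ⟨hm, hmt⟩ hbad
  have := hbad hm
  simp only [Pi.zero_apply, mul_eq_zero, ENNReal.ofReal_eq_zero, not_le.mpr
    (vandermondeProd_pos hm), false_or] at this
  exact hpos m hmt hm this

/-- **Weyl's integration formula** for functions of the eigenvalues of a symmetric matrix. -/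
theorem exists_lintegral_orderedEigenvalues (q : ℕ) : ∃ c : ℝ≥0∞, c ≠ 0 ∧ c ≠ ∞ ∧
    ∀ g : (Fin q → ℝ) → ℝ≥0∞, Measurable g →
      ∫⁻ S, g (orderedEigenvalues q S) ∂(lebSym q) =
        c * ∫⁻ l in {l : Fin q → ℝ | StrictMono l}, ENNReal.ofReal (vandermondeProd l) * g l := by
  obtain ⟨U, hU, h0, hUpos⟩ := exists_isOpen_cayley_chart q
  obtain ⟨k, hk0, hkt, hk⟩ := exists_lintegral_symSet q
  set s : Set (SymCoord q) := U ×ˢ {l | StrictMono l} with hs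
  have hsm : MeasurableSet s := hU.measurableSet.prod (isOpen_strictMono q).measurableSet
  have hinj : Set.InjOn spectralMap s := injOn_spectralMap hUpos
  have hWm : MeasurableSet (spectralMap '' s) :=
    hsm.image_of_continuousOn_injOn (continuous_spectralMap q).continuousOn hinj
  set J : ℝ≥0∞ := ∫⁻ x in U, ENNReal.ofReal |LinearMap.det (cayleyTangent x)| with hJ
  obtain ⟨l₀, hl₀, hl₀'⟩ := exists_strictMono_Ioo q
  -- The reference spectrum `l₀` is arbitrary; `m` is the Haar mass of the frames that bring it into
  -- the chart.
  set m : ℝ≥0∞ := haarOrthogonal q {O | (O : Matrix (Fin q) (Fin q) ℝ).transpose *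
    Matrix.diagonal l₀ * (O : Matrix (Fin q) (Fin q) ℝ) ∈ symSet (spectralMap '' s)} with hmdef
  have hm0 : m ≠ 0 := by
    refine ((Measure.measure_pos_of_mem_nhds (haarOrthogonal q)
      (cayley_chart_mem_nhds hU h0)).trans_le (measure_mono ?_)).ne'
    rintro O ⟨x, hx, hxO⟩
    refine mem_symSet_image.mpr ⟨(x, l₀), ⟨hx, hl₀⟩, ?_⟩
    simp only [hxO, Matrix.transpose_transpose]
  have hmt : m ≠ ∞ := measure_ne_top _ _
  -- Diagonalising `S = Q Λ Qᵀ` translates the set of frames by `Q⁻¹`, which preserves Haar measure,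
  -- and `Λ` may then be exchanged for `diag(l₀)`.
  have hmS : ∀ᵐ S ∂(lebSym q), haarOrthogonal q {O | (O : Matrix (Fin q) (Fin q) ℝ).transpose *
      S * (O : Matrix (Fin q) (Fin q) ℝ) ∈ symSet (spectralMap '' s)} = m := by
    filter_upwards [ae_strictMono_orderedEigenvalues q, ae_lebSym_isHermitian q] with S hS hSh
    obtain ⟨Q, hQ⟩ := exists_orthogonal_diagonalization hSh
    refine Eq.trans ?_ (measure_preimage_mul (haarOrthogonal q) Q⁻¹ _)
    congr 1
    ext O
    have h1 : (O : Matrix (Fin q) (Fin q) ℝ).transpose * S * (O : Matrix (Fin q) (Fin q) ℝ) =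
        ((Q⁻¹ * O : Matrix.orthogonalGroup (Fin q) ℝ) : Matrix (Fin q) (Fin q) ℝ).transpose *
          Matrix.diagonal (orderedEigenvalues q S) *
          ((Q⁻¹ * O : Matrix.orthogonalGroup (Fin q) ℝ) : Matrix (Fin q) (Fin q) ℝ) := by
      change _ = ((Q : Matrix (Fin q) (Fin q) ℝ).transpose *
        (O : Matrix (Fin q) (Fin q) ℝ)).transpose * _ *
        ((Q : Matrix (Fin q) (Fin q) ℝ).transpose * (O : Matrix (Fin q) (Fin q) ℝ))
      rw [Matrix.transpose_mul, Matrix.transpose_transpose]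
      conv_lhs => rw [hQ]
      simp only [Matrix.mul_assoc]
    rw [Set.mem_ofPred_eq, Set.mem_preimage, Set.mem_ofPred_eq, h1]
    exact ⟨conj_mem_symSet_of_strictMono hS hl₀ _, conj_mem_symSet_of_strictMono hl₀ hS _⟩
  -- Averaging turns the left side into an integral over the chart, where the change of variables
  -- applies and the Jacobian separates.
  have key : ∀ g : (Fin q → ℝ) → ℝ≥0∞, Measurable g →
      (∫⁻ S, g (orderedEigenvalues q S) ∂(lebSym q)) * m = k * (J *
        ∫⁻ l in {l : Fin q → ℝ | StrictMono l}, ENNReal.ofReal (vandermondeProd l) * g l) := by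
    intro g hg
    have hgm : Measurable fun S => g (orderedEigenvalues q S) :=
      hg.comp (measurable_orderedEigenvalues q)
    have havg := lintegral_mul_haar_conj_mem (q := q) hgm
      (fun O S hS => by rw [orderedEigenvalues_conj hS]) (measurableSet_symSet hWm)
    rw [hk _ hWm _ hgm, lintegral_image_eq_lintegral_abs_det_fderiv_mul volume hsm
      (fun v _ => (hasFDerivAt_spectralMap v).hasFDerivWithinAt) hinj] at havg
    rw [← lintegral_mul_const _ hgm]
    refine (lintegral_congr_ae ?_).trans (havg.trans ?_)
    · filter_upwards [hmS] with S hS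
      rw [hS]
    · congr 1
      have hcong : ∀ v ∈ s, ENNReal.ofReal
          |(LinearMap.toContinuousLinearMap (spectralDeriv v)).det| *
            g (orderedEigenvalues q (symMat q (spectralMap v))) =
          ENNReal.ofReal |LinearMap.det (cayleyTangent v.1)| *
            (ENNReal.ofReal (vandermondeProd v.2) * g v.2) := by
        rintro v ⟨-, hv⟩
        change StrictMono v.2 at hv
        rw [continuousLinearMap_det_spectralDeriv, symMat_spectralMap,
          orderedEigenvalues_conj_diagonal hv.monotone (cayley_transpose_mul _),
          abs_of_pos (vandermondeProd_pos hv), ENNReal.ofReal_mul (abs_nonneg _), mul_assoc]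
      rw [setLIntegral_congr_fun hsm hcong, hs, Measure.volume_eq_prod, ← Measure.prod_restrict]
      exact lintegral_prod_mul
        (continuous_det_cayleyTangent q).abs.measurable.ennreal_ofReal.aemeasurable
        ((continuous_vandermondeProd q).measurable.ennreal_ofReal.mul hg).aemeasurable
  have hform : ∀ g : (Fin q → ℝ) → ℝ≥0∞, Measurable g →
      ∫⁻ S, g (orderedEigenvalues q S) ∂(lebSym q) = (k * J / m) *
        ∫⁻ l in {l : Fin q → ℝ | StrictMono l}, ENNReal.ofReal (vandermondeProd l) * g l := by
    intro g hg
    have h1 := key g hg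
    rw [← mul_assoc] at h1
    rw [ENNReal.div_eq_inv_mul, mul_assoc, ← h1, mul_comm _ m, ← mul_assoc,
      ENNReal.inv_mul_cancel hm0 hmt, one_mul]
  -- No bound on `J` is available, so the constant is checked on test functions: `g = 1` excludes
  -- `0` because `lebSym` is nonzero, and the indicator of the open unit cube excludes `∞` because
  -- that spectrum set has finite measure.
  refine ⟨k * J / m, fun hc => ?_, fun hc => ?_, hform⟩
  · have h1 := hform 1 measurable_one
    rw [hc, zero_mul] at h1
    have h2 := hk Set.univ MeasurableSet.univ 1 measurable_one
    have h3 : ∫⁻ S in symSet (Set.univ : Set (SymCoord q)), (1 : Matrix (Fin q) (Fin q) ℝ → ℝ≥0∞) S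
        ∂(lebSym q) = 0 :=
      le_antisymm ((setLIntegral_le_lintegral _ _).trans h1.le) zero_le
    rw [h3] at h2
    have hpos := isOpen_univ.measure_pos (volume : Measure (SymCoord q)) ⟨0, trivial⟩
    simp only [Pi.one_apply, setLIntegral_one] at h2
    exact (mul_ne_zero hk0 hpos.ne') h2.symm
  · set t : Set (Fin q → ℝ) := {l | ∀ i, l i ∈ Set.Ioo (0 : ℝ) 1} with ht
    have hto : IsOpen t := by
      rw [ht, Set.ofPred_forall]
      exact isOpen_iInter_of_finite fun i => isOpen_Ioo.preimage (continuous_apply i)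
    have h1 := hform (t.indicator 1) (measurable_one.indicator hto.measurableSet)
    rw [hc, ENNReal.top_mul (lintegral_strictMono_pos hto
      (measurable_one.indicator hto.measurableSet) (fun l hl _ => by simp [hl])
      ⟨l₀, hl₀', hl₀⟩)] at h1
    refine (lebSym_eigenvalues_Ioo_lt_top q).ne ?_
    rw [← h1]
    refine (lintegral_indicator_one (μ := lebSym q) ((isClosed_isHermitian q).measurableSet.inter
      (measurable_orderedEigenvalues q hto.measurableSet))).symm.trans ?_
    refine lintegral_congr_ae ?_
    filter_upwards [ae_lebSym_isHermitian q] with S hS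
    by_cases h : orderedEigenvalues q S ∈ t
    · have h' : S ∈ {S | S.IsHermitian} ∩ orderedEigenvalues q ⁻¹' t := ⟨hS, h⟩
      rw [Set.indicator_of_mem h, Set.indicator_of_mem h']
      rfl
    · rw [Set.indicator_of_notMem h, Set.indicator_of_notMem (fun h' => h h'.2)]

end WeylIntegration

/-! ### The multivariate Gamma and Beta integrals. -/

section MultivariateGamma

theorem measurable_matrix_det (q : ℕ) :
    Measurable fun S : Matrix (Fin q) (Fin q) ℝ => S.det :=
  (continuous_id.matrix_det).measurable

theorem measurable_matrix_trace (q : ℕ) :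
    Measurable fun S : Matrix (Fin q) (Fin q) ℝ => S.trace :=
  (continuous_id.matrix_trace).measurable

theorem isOpen_forall_pos (q : ℕ) : IsOpen {l : Fin q → ℝ | ∀ i, 0 < l i} := by
  rw [Set.ofPred_forall]
  exact isOpen_iInter_of_finite fun i => isOpen_lt continuous_const (continuous_apply i)

/-- Weyl's integration formula on the cone of positive definite matrices. -/
theorem exists_lintegral_posDef (q : ℕ) : ∃ c : ℝ≥0∞, c ≠ 0 ∧ c ≠ ∞ ∧
    ∀ g : (Fin q → ℝ) → ℝ≥0∞, Measurable g →
      ∫⁻ S in {S | S.PosDef}, g (orderedEigenvalues q S) ∂(lebSym q) =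
        c * ∫⁻ l in {l : Fin q → ℝ | StrictMono l}, ENNReal.ofReal (vandermondeProd l) *
          {l : Fin q → ℝ | ∀ i, 0 < l i}.indicator g l := by
  obtain ⟨c, hc0, hct, hc⟩ := exists_lintegral_orderedEigenvalues q
  refine ⟨c, hc0, hct, fun g hg => ?_⟩
  rw [← hc _ (hg.indicator (isOpen_forall_pos q).measurableSet),
    ← lintegral_indicator (measurableSet_posDef q)]
  refine lintegral_congr_ae ?_
  filter_upwards [ae_lebSym_isHermitian q] with S hS
  by_cases h : S.PosDef
  · have h' : orderedEigenvalues q S ∈ {l : Fin q → ℝ | ∀ i, 0 < l i} :=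
      (posDef_iff_orderedEigenvalues_pos.mp h).2
    rw [Set.indicator_of_mem (show S ∈ {S | S.PosDef} from h), Set.indicator_of_mem h']
  · have h' : orderedEigenvalues q S ∉ {l : Fin q → ℝ | ∀ i, 0 < l i} :=
      fun h' => h (posDef_iff_orderedEigenvalues_pos.mpr ⟨hS, h'⟩)
    rw [Set.indicator_of_notMem (show S ∉ {S | S.PosDef} from h), Set.indicator_of_notMem h']

/-- The multivariate Gamma integral, as an extended nonnegative number. -/
noncomputable def gammaLIntegral (q : ℕ) (a : ℝ) : ℝ≥0∞ :=
  ∫⁻ S in {S : Matrix (Fin q) (Fin q) ℝ | S.PosDef},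
    ENNReal.ofReal (Real.exp (-S.trace) * S.det ^ (a - ((q : ℝ) + 1) / 2)) ∂(lebSym q)

/-- Each gap satisfies `l j - l i ≤ (1 + l i) * (1 + l j)`, and every index belongs to `q - 1`
pairs. The bound is a product over coordinates. -/
theorem vandermondeProd_le {q : ℕ} {l : Fin q → ℝ} (hl : StrictMono l) (hpos : ∀ i, 0 < l i) :
    vandermondeProd l ≤ ∏ i, (1 + l i) ^ (q - 1) := by
  calc vandermondeProd l ≤ ∏ i, ∏ j ∈ Finset.Ioi i, (1 + l i) * (1 + l j) := by
        refine Finset.prod_le_prod (fun i _ => Finset.prod_nonneg fun j hj =>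
          sub_nonneg.mpr (hl (Finset.mem_Ioi.mp hj)).le) fun i _ => Finset.prod_le_prod
          (fun j hj => sub_nonneg.mpr (hl (Finset.mem_Ioi.mp hj)).le) fun j _ => ?_
        nlinarith [hpos i, hpos j, mul_pos (hpos i) (hpos j)]
    _ = _ := by
        rw [Finset.prod_prod_Ioi_mul_eq_prod_prod_off_diag (fun _ i => 1 + l i)]
        refine Finset.prod_congr rfl fun i _ => ?_
        rw [Finset.prod_const, Finset.card_compl, Finset.card_singleton, Fintype.card_fin]

/-- The binomial theorem reduces this to finitely many convergent Gamma integrals. -/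
theorem integrable_one_add_pow_mul_exp_mul_rpow (n : ℕ) {b : ℝ} (hb : -1 < b) :
    Integrable ((Set.Ioi (0 : ℝ)).indicator fun x => (1 + x) ^ n * (Real.exp (-x) * x ^ b)) := by
  rw [integrable_indicator_iff measurableSet_Ioi]
  have hsum : IntegrableOn (fun x : ℝ => ∑ m ∈ Finset.range (n + 1),
      (n.choose m : ℝ) * (Real.exp (-x) * x ^ ((b + 1 + (n - m : ℕ)) - 1))) (Set.Ioi 0) := by
    refine integrable_finsetSum _ fun m _ => Integrable.const_mul ?_ _
    exact Real.GammaIntegral_convergent (by have : (0 : ℝ) ≤ ((n - m : ℕ) : ℝ) := Nat.cast_nonneg _; linarith)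
  refine hsum.congr_fun (fun x hx => ?_) measurableSet_Ioi
  rw [add_pow, Finset.sum_mul]
  refine Finset.sum_congr rfl fun m _ => ?_
  rw [show b + 1 + ((n - m : ℕ) : ℝ) - 1 = b + ((n - m : ℕ) : ℝ) by ring,
    Real.rpow_add_natCast (ne_of_gt hx)]
  ring

theorem exp_neg_trace_mul_det_rpow {q : ℕ} {S : Matrix (Fin q) (Fin q) ℝ} (hS : S.PosDef)
    (b : ℝ) : Real.exp (-S.trace) * S.det ^ b =
      ∏ i, (Real.exp (-orderedEigenvalues q S i) * orderedEigenvalues q S i ^ b) := by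
  have hp := (posDef_iff_orderedEigenvalues_pos.mp hS).2
  rw [trace_eq_sum_orderedEigenvalues hS.1, det_eq_prod_orderedEigenvalues hS.1,
    Finset.prod_mul_distrib, Real.finsetProd_rpow _ _ (fun i _ => (hp i).le),
    ← Finset.sum_neg_distrib, Real.exp_sum]

/-- In eigenvalue coordinates the integrand is a Vandermonde product times one-dimensional Gamma
weights, and the Vandermonde bound makes it dominated by a product of integrable functions. The
threshold on `a` is exactly `b > -1`. -/
theorem gammaLIntegral_ne_zero_ne_top {q : ℕ} {a : ℝ} (ha : ((q : ℝ) - 1) / 2 < a) :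
    gammaLIntegral q a ≠ 0 ∧ gammaLIntegral q a ≠ ∞ := by
  obtain ⟨c, hc0, hct, hc⟩ := exists_lintegral_posDef q
  set b := a - ((q : ℝ) + 1) / 2 with hb
  set g : (Fin q → ℝ) → ℝ≥0∞ := fun l => ENNReal.ofReal (∏ i, (Real.exp (-l i) * l i ^ b)) with hg
  have hgm : Measurable g := by
    refine Measurable.ennreal_ofReal (Finset.measurable_prod _ fun i _ => ?_)
    exact (Real.measurable_exp.comp (measurable_pi_apply i).neg).mul
      ((measurable_pi_apply i).pow_const b)
  have h1 : gammaLIntegral q a = ∫⁻ S in {S | S.PosDef}, g (orderedEigenvalues q S) ∂(lebSym q) :=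
    setLIntegral_congr_fun (measurableSet_posDef q) fun S hS => by
      rw [exp_neg_trace_mul_det_rpow hS]
  rw [h1, hc g hgm]
  constructor
  · refine mul_ne_zero hc0 (lintegral_strictMono_pos (isOpen_forall_pos q)
      (hgm.indicator (isOpen_forall_pos q).measurableSet) (fun l hl _ => ?_) ?_)
    · rw [Set.indicator_of_mem hl]
      have hl' : ∀ i, 0 < l i := hl
      have : 0 < ∏ i, (Real.exp (-l i) * l i ^ b) :=
        Finset.prod_pos fun i _ => mul_pos (Real.exp_pos _) (Real.rpow_pos_of_pos (hl' i) _)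
      exact (ENNReal.ofReal_pos.mpr this).ne'
    · obtain ⟨l, hl, hl'⟩ := exists_strictMono_Ioo q
      exact ⟨l, fun i => (hl' i).1, hl⟩
  · refine ENNReal.mul_ne_top hct (ne_of_lt ?_)
    set h : ℝ → ℝ := (Set.Ioi (0 : ℝ)).indicator
      fun x => (1 + x) ^ (q - 1) * (Real.exp (-x) * x ^ b) with hh
    have hint : Integrable fun l : Fin q → ℝ => ∏ i, h (l i) :=
      Integrable.fintype_prod fun _ =>
        integrable_one_add_pow_mul_exp_mul_rpow (q - 1) (by rw [hb]; linarith)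
    refine lt_of_le_of_lt ?_ hint.lintegral_lt_top
    refine (setLIntegral_mono' (isOpen_strictMono q).measurableSet fun l hl => ?_).trans
      (setLIntegral_le_lintegral _ _)
    by_cases hp : l ∈ {l : Fin q → ℝ | ∀ i, 0 < l i}
    · have hp' : ∀ i, 0 < l i := hp
      rw [Set.indicator_of_mem hp, hg, ← ENNReal.ofReal_mul (vandermondeProd_nonneg
        (StrictMono.monotone hl))]
      refine ENNReal.ofReal_le_ofReal ?_
      have h2 : ∏ i, h (l i) = (∏ i, (1 + l i) ^ (q - 1)) * ∏ i, (Real.exp (-l i) * l i ^ b) := by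
        rw [← Finset.prod_mul_distrib]
        exact Finset.prod_congr rfl fun i _ => Set.indicator_of_mem (hp' i) _
      rw [h2]
      exact mul_le_mul_of_nonneg_right (vandermondeProd_le hl hp')
        (Finset.prod_nonneg fun i _ => mul_nonneg (Real.exp_pos _).le
          (Real.rpow_nonneg (hp' i).le _))
    · rw [Set.indicator_of_notMem hp, mul_zero]
      exact zero_le

theorem multivariateGamma_eq_toReal (q : ℕ) (a : ℝ) :
    multivariateGamma q a = (gammaLIntegral q a).toReal := by
  rw [multivariateGamma, gammaLIntegral, integral_eq_lintegral_of_nonneg_ae]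
  · refine (ae_restrict_iff' (measurableSet_posDef q)).mpr (Filter.Eventually.of_forall ?_)
    intro S hS
    exact mul_nonneg (Real.exp_pos _).le (Real.rpow_nonneg (Matrix.PosDef.det_pos hS).le _)
  · exact ((Real.measurable_exp.comp (measurable_matrix_trace q).neg).mul
      ((measurable_matrix_det q).pow_const _)).aestronglyMeasurable

theorem exists_transpose_mul_self_of_posDef {q : ℕ} {A : Matrix (Fin q) (Fin q) ℝ}
    (hA : A.PosDef) : ∃ B : Matrix (Fin q) (Fin q) ℝ, A = B.transpose * B := by
  obtain ⟨O, hO⟩ := exists_orthogonal_diagonalization hA.1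
  have hp := (posDef_iff_orderedEigenvalues_pos.mp hA).2
  refine ⟨Matrix.diagonal (fun i => √(orderedEigenvalues q A i)) *
    (O : Matrix (Fin q) (Fin q) ℝ).transpose, ?_⟩
  rw [Matrix.transpose_mul, Matrix.transpose_transpose, Matrix.diagonal_transpose,
    Matrix.mul_assoc, ← Matrix.mul_assoc (Matrix.diagonal _), Matrix.diagonal_mul_diagonal,
    ← Matrix.mul_assoc]
  simp_rw [Real.mul_self_sqrt (hp _).le]
  exact hO

/-- Write `A = Bᵀ B` and substitute `S ↦ B S Bᵀ`: the trace becomes `tr(A S)`, the determinant gains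
`det A`, and the Jacobian `|det B|^(q+1)` is `(det A)^((q+1)/2)`. -/
theorem lintegral_exp_neg_trace_mul {q : ℕ} {A : Matrix (Fin q) (Fin q) ℝ} (hA : A.PosDef)
    (a : ℝ) :
    ∫⁻ S in {S : Matrix (Fin q) (Fin q) ℝ | S.PosDef},
      ENNReal.ofReal (Real.exp (-(A * S).trace) * S.det ^ (a - ((q : ℝ) + 1) / 2)) ∂(lebSym q) =
      ENNReal.ofReal (A.det ^ (-a)) * gammaLIntegral q a := by
  obtain ⟨B, rfl⟩ := exists_transpose_mul_self_of_posDef hA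
  have hdet : (B.transpose * B).det = |B.det| ^ 2 := by
    rw [Matrix.det_mul, Matrix.det_transpose, sq_abs, sq]
  have hApos := hA.det_pos
  have hB0 : B.det ≠ 0 := by
    intro h
    rw [hdet, h] at hApos
    simp at hApos
  have hBpos : 0 < |B.det| := abs_pos.mpr hB0
  set b := a - ((q : ℝ) + 1) / 2 with hb
  set g : Matrix (Fin q) (Fin q) ℝ → ℝ≥0∞ := {S | S.PosDef}.indicator fun S =>
    ENNReal.ofReal (Real.exp (-S.trace) * S.det ^ b) with hg
  have hgm : Measurable g := by
    refine Measurable.indicator ?_ (measurableSet_posDef q)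
    exact ((Real.measurable_exp.comp (measurable_matrix_trace q).neg).mul
      ((measurable_matrix_det q).pow_const _)).ennreal_ofReal
  have hchange := lintegral_lebSym_conj hB0 hgm
  rw [hg, lintegral_indicator (measurableSet_posDef q)] at hchange
  have hfun : (fun S => g (B * S * B.transpose)) = fun S =>
      ENNReal.ofReal ((B.transpose * B).det ^ b) *
      ({S : Matrix (Fin q) (Fin q) ℝ | S.PosDef}.indicator fun S => ENNReal.ofReal
        (Real.exp (-(B.transpose * B * S).trace) * S.det ^ b)) S := by
    funext S
    have hiff : (B * S * B.transpose).PosDef ↔ S.PosDef :=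
      Matrix.IsUnit.posDef_star_right_conjugate_iff
        ((Matrix.isUnit_iff_isUnit_det B).mpr (isUnit_iff_ne_zero.mpr hB0))
    by_cases hS : S.PosDef
    · rw [hg, Set.indicator_of_mem (show B * S * B.transpose ∈ {S | S.PosDef} from hiff.mpr hS),
        Set.indicator_of_mem (show S ∈ {S | S.PosDef} from hS),
        ← ENNReal.ofReal_mul (Real.rpow_nonneg hApos.le _)]
      congr 1
      have htr : (B * S * B.transpose).trace = (B.transpose * B * S).trace := by
        rw [Matrix.trace_mul_comm, Matrix.mul_assoc]
      have hdt : (B * S * B.transpose).det = (B.transpose * B).det * S.det := by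
        simp only [Matrix.det_mul, Matrix.det_transpose]
        ring
      rw [htr, hdt, Real.mul_rpow hApos.le hS.det_pos.le]
      ring
    · rw [hg, Set.indicator_of_notMem 
        (show B * S * B.transpose ∉ {S | S.PosDef} from fun h => hS (hiff.mp h)),
        Set.indicator_of_notMem (show S ∉ {S | S.PosDef} from hS), mul_zero]
  have hm2 : Measurable ({S : Matrix (Fin q) (Fin q) ℝ | S.PosDef}.indicator fun S =>
      ENNReal.ofReal (Real.exp (-(B.transpose * B * S).trace) * S.det ^ b)) := by
    refine Measurable.indicator ?_ (measurableSet_posDef q)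
    exact ((Real.measurable_exp.comp ((measurable_matrix_trace q).comp
      (continuous_const.matrix_mul continuous_id).measurable).neg).mul
      ((measurable_matrix_det q).pow_const _)).ennreal_ofReal
  rw [← hg, hfun, lintegral_const_mul _ hm2, lintegral_indicator (measurableSet_posDef q)]
    at hchange
  have hpos : 0 < (B.transpose * B).det ^ (-b) := Real.rpow_pos_of_pos hApos _
  have hmul := congrArg (ENNReal.ofReal ((B.transpose * B).det ^ (-b)) * ·) hchange
  rw [← mul_assoc, ← mul_assoc, ← ENNReal.ofReal_mul hpos.le, ← ENNReal.ofReal_mul hpos.le,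
    ← Real.rpow_add hApos, neg_add_cancel, Real.rpow_zero, ENNReal.ofReal_one, one_mul] at hmul
  rw [hmul, gammaLIntegral]
  congr 2
  rw [abs_inv, abs_pow, hdet, ← Real.rpow_natCast, ← Real.rpow_natCast, ← Real.rpow_neg hBpos.le,
    ← Real.rpow_mul hBpos.le, ← Real.rpow_mul hBpos.le, ← Real.rpow_add hBpos]
  congr 1
  rw [hb]
  push_cast
  ring

/-- The matrix-variate Beta integral of the second kind. -/
theorem lintegral_beta_mul_gammaLIntegral (p q : ℕ) :
    (∫⁻ S in {S : Matrix (Fin q) (Fin q) ℝ | S.PosDef},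
      ENNReal.ofReal (S.det ^ ((p : ℝ) / 2 - ((q : ℝ) + 1) / 2) / (1 + S).det ^ p) ∂(lebSym q)) *
      gammaLIntegral q p = gammaLIntegral q ((p : ℝ) / 2) ^ 2 := by
  set ν := (lebSym q).restrict {S : Matrix (Fin q) (Fin q) ℝ | S.PosDef} with hν
  have hνae : ∀ᵐ S ∂ν, S.PosDef := ae_restrict_mem (measurableSet_posDef q)
  set b := (p : ℝ) / 2 - ((q : ℝ) + 1) / 2 with hb
  set d := (p : ℝ) - ((q : ℝ) + 1) / 2 with hd
  -- Integrating `F` over `S` first gives `det(1+E)^(-p) * Γ_q(p)`. Integrating over `E` first gives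
  -- `det(S)^(-p/2) * Γ_q(p/2)`, and since `d - p/2 = b` the remaining integral is `Γ_q(p/2)` again.
  let F : Matrix (Fin q) (Fin q) ℝ → Matrix (Fin q) (Fin q) ℝ → ℝ≥0∞ := fun E S =>
    ENNReal.ofReal (E.det ^ b) *
      ENNReal.ofReal (Real.exp (-((1 + E) * S).trace) * S.det ^ d)
  have hFm : Measurable (Function.uncurry F) := by
    have h1 : Measurable fun x : Matrix (Fin q) (Fin q) ℝ × Matrix (Fin q) (Fin q) ℝ =>
        ((1 + x.1) * x.2).trace :=
      ((continuous_const.add continuous_fst).matrix_mul continuous_snd).matrix_trace.measurable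
    exact (((measurable_matrix_det q).comp measurable_fst).pow_const b).ennreal_ofReal.mul
      (((Real.measurable_exp.comp h1.neg)).mul
        (((measurable_matrix_det q).comp measurable_snd).pow_const d)).ennreal_ofReal
  have hE : ∀ᵐ E ∂ν, ENNReal.ofReal (E.det ^ b / (1 + E).det ^ p) * gammaLIntegral q p =
      ∫⁻ S, F E S ∂ν := by
    filter_upwards [hνae] with E hE
    have h1E : (1 + E).PosDef := Matrix.PosDef.one.add hE
    have hm : Measurable fun S : Matrix (Fin q) (Fin q) ℝ =>
        ENNReal.ofReal (Real.exp (-((1 + E) * S).trace) * S.det ^ d) :=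
      ((Real.measurable_exp.comp ((measurable_matrix_trace q).comp
        (continuous_const.matrix_mul continuous_id).measurable).neg).mul
        ((measurable_matrix_det q).pow_const _)).ennreal_ofReal
    rw [lintegral_const_mul _ hm, hν, lintegral_exp_neg_trace_mul h1E, ← mul_assoc,
      ← ENNReal.ofReal_mul (Real.rpow_nonneg hE.det_pos.le _), Real.rpow_neg h1E.det_pos.le,
      Real.rpow_natCast, div_eq_mul_inv]
  have hS : ∀ᵐ S ∂ν, ∫⁻ E, F E S ∂ν =
      ENNReal.ofReal (Real.exp (-S.trace) * S.det ^ b) * gammaLIntegral q ((p : ℝ) / 2) := by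
    filter_upwards [hνae] with S hS
    have hm : Measurable fun E : Matrix (Fin q) (Fin q) ℝ =>
        ENNReal.ofReal (Real.exp (-(S * E).trace) * E.det ^ b) :=
      ((Real.measurable_exp.comp ((measurable_matrix_trace q).comp
        (continuous_const.matrix_mul continuous_id).measurable).neg).mul
        ((measurable_matrix_det q).pow_const _)).ennreal_ofReal
    have hF : ∀ᵐ E ∂ν, F E S = ENNReal.ofReal (Real.exp (-S.trace) * S.det ^ d) *
        ENNReal.ofReal (Real.exp (-(S * E).trace) * E.det ^ b) := by
      filter_upwards [hνae] with E hE
      simp only [F]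
      rw [← ENNReal.ofReal_mul (Real.rpow_nonneg hE.det_pos.le _), ← ENNReal.ofReal_mul
        (mul_nonneg (Real.exp_pos _).le (Real.rpow_nonneg hS.det_pos.le _)), Matrix.add_mul,
        Matrix.one_mul, Matrix.trace_add, neg_add, Real.exp_add, Matrix.trace_mul_comm E S]
      congr 1
      ring
    rw [lintegral_congr_ae hF, lintegral_const_mul _ hm, hν, lintegral_exp_neg_trace_mul hS,
      ← mul_assoc, ← ENNReal.ofReal_mul (mul_nonneg (Real.exp_pos _).le
        (Real.rpow_nonneg hS.det_pos.le _)), mul_assoc, ← Real.rpow_add hS.det_pos]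
    congr 4
    rw [hb, hd]
    ring
  have hm1 : Measurable fun S : Matrix (Fin q) (Fin q) ℝ =>
      ENNReal.ofReal (S.det ^ b / (1 + S).det ^ p) :=
    (((measurable_matrix_det q).pow_const b).div (((measurable_matrix_det q).comp
      (continuous_const.add continuous_id).measurable).pow_const p)).ennreal_ofReal
  have hm2 : Measurable fun S : Matrix (Fin q) (Fin q) ℝ =>
      ENNReal.ofReal (Real.exp (-S.trace) * S.det ^ b) :=
    ((Real.measurable_exp.comp (measurable_matrix_trace q).neg).mul
      ((measurable_matrix_det q).pow_const _)).ennreal_ofReal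
  rw [← lintegral_mul_const _ hm1, lintegral_congr_ae hE,
    lintegral_lintegral_swap hFm.aemeasurable, lintegral_congr_ae hS, lintegral_mul_const _ hm2, sq]
  rfl

end MultivariateGamma

/-! ### The noise law at `ρ = 0` and its image under the eigenvalue map. -/

section NoiseLaw

instance isProbabilityMeasure_uniformStiefel (p q : ℕ) (hqp : q ≤ p) :
    IsProbabilityMeasure (uniformStiefel p q hqp) := by
  refine Measure.isProbabilityMeasure_map (μ := haarOrthogonal p) (Measurable.aemeasurable ?_)
  exact (continuous_subtype_val.matrix_submatrix _ _).measurable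

-- The `U`-terms carry the factor `√0`, so the inner integral is that of a constant against a
-- probability measure. The power of the determinant from `muPos` then merges with `det(S)^(p/2)`.
open scoped MatrixOrder in
theorem mpcnNoiseLaw_zero (p q : ℕ) (hqp : q ≤ p) :
    mpcnNoiseLaw p q hqp 0 = ((lebSym q).restrict {S | S.PosDef}).withDensity fun S =>
      ENNReal.ofReal (mpcnConst p q) * ENNReal.ofReal
        (S.det ^ ((p : ℝ) / 2 - ((q : ℝ) + 1) / 2) / (1 + S).det ^ p) := by
  have hw : (fun ε : Matrix (Fin q) (Fin q) ℝ =>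
      ENNReal.ofReal (mpcnConst p q) * ENNReal.ofReal (ε.det ^ ((p : ℝ) / 2) / (1 + ε).det ^ p)) =
      fun ε => ENNReal.ofReal ((1 - 0) ^ ((p : ℝ) * q / 2) * mpcnConst p q) *
      ∫⁻ U, ENNReal.ofReal (ε.det ^ ((p : ℝ) / 2) /
        (1 + ε - √0 • (firstRows p q hqp U * CFC.sqrt ε +
          CFC.sqrt ε * (firstRows p q hqp U).transpose)).det ^ p) ∂(uniformStiefel p q hqp) := by
    funext ε
    simp
  have h1 : Measurable fun S : Matrix (Fin q) (Fin q) ℝ =>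
      ENNReal.ofReal (S.det ^ (-((q : ℝ) + 1) / 2)) :=
    ((measurable_matrix_det q).pow_const _).ennreal_ofReal
  have h2 : Measurable fun ε : Matrix (Fin q) (Fin q) ℝ =>
      ENNReal.ofReal (mpcnConst p q) *
        ENNReal.ofReal (ε.det ^ ((p : ℝ) / 2) / (1 + ε).det ^ p) :=
    (((measurable_matrix_det q).pow_const _).div (((measurable_matrix_det q).comp
      (continuous_const.add continuous_id).measurable).pow_const p)).ennreal_ofReal.const_mul _
  unfold mpcnNoiseLaw
  rw [← hw, muPos, ← withDensity_mul _ h1 h2]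
  refine withDensity_congr_ae ?_
  filter_upwards [ae_restrict_mem (measurableSet_posDef q)] with S hS
  have hd := Matrix.PosDef.det_pos hS
  rw [Pi.mul_apply, mul_left_comm, ← ENNReal.ofReal_mul (Real.rpow_nonneg hd.le _),
    ← mul_div_assoc, ← Real.rpow_add hd,
    show -((q : ℝ) + 1) / 2 + (p : ℝ) / 2 = (p : ℝ) / 2 - ((q : ℝ) + 1) / 2 by ring]

/-- The Beta integral is the inverse of `mpcnConst`; the cancellation is legitimate because `q ≤ p`
and `1 ≤ q` place both `p` and `p/2` above the threshold `(q-1)/2`. -/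
theorem mpcnConst_mul_lintegral (p q : ℕ) (hq : 1 ≤ q) (hqp : q ≤ p) :
    ENNReal.ofReal (mpcnConst p q) * ∫⁻ S in {S : Matrix (Fin q) (Fin q) ℝ | S.PosDef},
      ENNReal.ofReal (S.det ^ ((p : ℝ) / 2 - ((q : ℝ) + 1) / 2) / (1 + S).det ^ p)
        ∂(lebSym q) = 1 := by
  have hqp' : (q : ℝ) ≤ p := by exact_mod_cast hqp
  have hq' : (1 : ℝ) ≤ q := by exact_mod_cast hq
  obtain ⟨h10, h1t⟩ := gammaLIntegral_ne_zero_ne_top (q := q) (a := p) (by linarith)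
  obtain ⟨h20, h2t⟩ := gammaLIntegral_ne_zero_ne_top (q := q) (a := (p : ℝ) / 2) (by linarith)
  have hC : ENNReal.ofReal (mpcnConst p q) =
      gammaLIntegral q p / gammaLIntegral q ((p : ℝ) / 2) ^ 2 := by
    rw [mpcnConst, multivariateGamma_eq_toReal, multivariateGamma_eq_toReal, ← ENNReal.toReal_pow,
      ← ENNReal.toReal_div, ENNReal.ofReal_toReal]
    exact ENNReal.div_ne_top h1t (pow_ne_zero _ h20)
  rw [hC, ENNReal.div_eq_inv_mul, mul_assoc, mul_comm (gammaLIntegral q p),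
    lintegral_beta_mul_gammaLIntegral]
  exact ENNReal.inv_mul_cancel (pow_ne_zero _ h20) (ENNReal.pow_ne_top h2t)

theorem eigenvalueWeight_nonneg (p q : ℕ) (l : Fin q → ℝ) : 0 ≤ eigenvalueWeight p q l := by
  unfold eigenvalueWeight
  split_ifs with h
  · refine mul_nonneg (Finset.prod_nonneg fun i _ => div_nonneg (Real.rpow_nonneg (h.1 i).le _)
      (pow_nonneg ?_ _)) (vandermondeProd_nonneg h.2)
    linarith [h.1 i]
  · exact le_rfl

/-- Weyl's formula lives on strictly increasing vectors while the weight allows ties; there is no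
discrepancy because the Vandermonde product vanishes on ties. -/
theorem ofReal_eigenvalueWeight (p q : ℕ) (l : Fin q → ℝ) :
    ENNReal.ofReal (eigenvalueWeight p q l) = {l : Fin q → ℝ | StrictMono l}.indicator (fun l =>
      ENNReal.ofReal (vandermondeProd l) * {l : Fin q → ℝ | ∀ i, 0 < l i}.indicator (fun l =>
        ENNReal.ofReal (∏ i, l i ^ (((p : ℝ) - q - 1) / 2) / (1 + l i) ^ p)) l) l := by
  by_cases hl : l ∈ {l : Fin q → ℝ | StrictMono l}
  · have hl' : StrictMono l := hl
    rw [Set.indicator_of_mem hl]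
    by_cases hp : l ∈ {l : Fin q → ℝ | ∀ i, 0 < l i}
    · have hp' : ∀ i, 0 < l i := hp
      rw [Set.indicator_of_mem hp, eigenvalueWeight, if_pos ⟨hp', hl'.monotone⟩,
        ← ENNReal.ofReal_mul (vandermondeProd_nonneg hl'.monotone), mul_comm]
      rfl
    · rw [Set.indicator_of_notMem hp, eigenvalueWeight, if_neg fun h => hp h.1]
      simp
  · rw [Set.indicator_of_notMem hl, eigenvalueWeight]
    split_ifs with h
    · have hV : vandermondeProd l = 0 :=
        by_contra fun hV => hl (strictMono_of_vandermondeProd_ne_zero h.2 hV)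
      rw [vandermondeProd] at hV
      rw [hV, mul_zero, ENNReal.ofReal_zero]
    · exact ENNReal.ofReal_zero

theorem measurable_prod_rpow_div (p q : ℕ) (b : ℝ) : Measurable fun l : Fin q → ℝ =>
    ENNReal.ofReal (∏ i, l i ^ b / (1 + l i) ^ p) :=
  (Finset.measurable_prod _ fun i _ => ((measurable_pi_apply i).pow_const b).div
    ((measurable_const.add (measurable_pi_apply i)).pow_const p)).ennreal_ofReal

theorem measurable_ofReal_eigenvalueWeight (p q : ℕ) :
    Measurable fun l => ENNReal.ofReal (eigenvalueWeight p q l) := by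
  simp_rw [ofReal_eigenvalueWeight]
  exact ((continuous_vandermondeProd q).measurable.ennreal_ofReal.mul
    ((measurable_prod_rpow_div p q _).indicator (isOpen_forall_pos q).measurableSet)).indicator
      (isOpen_strictMono q).measurableSet

theorem measurable_eigenvalueWeight (p q : ℕ) : Measurable (eigenvalueWeight p q) := by
  have := (measurable_ofReal_eigenvalueWeight p q).ennreal_toReal
  simpa only [ENNReal.toReal_ofReal (eigenvalueWeight_nonneg p q _)] using this

/-- The density factors through the eigenvalues, `det S` and `det(1+S)` being the products of the `λ
i` and of the `1 + λ i`, so Weyl's formula applies on each Borel set. The value of `K` is left to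
the normalisation. -/
theorem exists_map_orderedEigenvalues_mpcnNoiseLaw (p q : ℕ) (hqp : q ≤ p) : ∃ K : ℝ≥0∞,
    (mpcnNoiseLaw p q hqp 0).map (orderedEigenvalues q) =
      K • (volume : Measure (Fin q → ℝ)).withDensity fun l =>
        ENNReal.ofReal (eigenvalueWeight p q l) := by
  obtain ⟨c, -, -, hc⟩ := exists_lintegral_posDef q
  refine ⟨c * ENNReal.ofReal (mpcnConst p q), ?_⟩
  set φ : (Fin q → ℝ) → ℝ≥0∞ := fun l =>
    ENNReal.ofReal (∏ i, l i ^ (((p : ℝ) - q - 1) / 2) / (1 + l i) ^ p) with hφ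
  have hφm : Measurable φ := measurable_prod_rpow_div p q _
  ext B hB
  have hpre := measurable_orderedEigenvalues q hB
  have hgm : Measurable fun l => ENNReal.ofReal (mpcnConst p q) * B.indicator φ l :=
    (hφm.indicator hB).const_mul _
  rw [Measure.map_apply (measurable_orderedEigenvalues q) hB, mpcnNoiseLaw_zero,
    withDensity_apply _ hpre, Measure.smul_apply, withDensity_apply _ hB, smul_eq_mul,
    ← lintegral_indicator hpre]
  have h1 : ∀ S ∈ {S : Matrix (Fin q) (Fin q) ℝ | S.PosDef},
      (orderedEigenvalues q ⁻¹' B).indicator (fun S => ENNReal.ofReal (mpcnConst p q) *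
        ENNReal.ofReal (S.det ^ ((p : ℝ) / 2 - ((q : ℝ) + 1) / 2) / (1 + S).det ^ p)) S =
      (fun l => ENNReal.ofReal (mpcnConst p q) * B.indicator φ l) (orderedEigenvalues q S) := by
    intro S hS
    have hp := (posDef_iff_orderedEigenvalues_pos.mp hS).2
    have hSh : S.IsHermitian := Matrix.PosDef.isHermitian hS
    by_cases h : orderedEigenvalues q S ∈ B
    · rw [Set.indicator_of_mem (show S ∈ orderedEigenvalues q ⁻¹' B from h)]
      simp only [Set.indicator_of_mem h, hφ]
      rw [Finset.prod_div_distrib, Finset.prod_pow, ← det_one_add_eq_prod_orderedEigenvalues hSh,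
        Real.finsetProd_rpow _ _ (fun i _ => (hp i).le), ← det_eq_prod_orderedEigenvalues hSh]
      congr 5
      ring
    · rw [Set.indicator_of_notMem (show S ∉ orderedEigenvalues q ⁻¹' B from h)]
      simp only [Set.indicator_of_notMem h, mul_zero]
  rw [setLIntegral_congr_fun (measurableSet_posDef q) h1, hc _ hgm, mul_assoc,
    ← lintegral_const_mul _ (measurable_ofReal_eigenvalueWeight p q),
    ← lintegral_indicator (isOpen_strictMono q).measurableSet, ← lintegral_indicator hB]
  congr 1
  refine lintegral_congr fun l => ?_
  by_cases hl : l ∈ {l : Fin q → ℝ | StrictMono l} <;>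
    by_cases hp : l ∈ {l : Fin q → ℝ | ∀ i, 0 < l i} <;>
    by_cases hb : l ∈ B <;>
    simp only [ofReal_eigenvalueWeight, Set.indicator_of_mem, Set.indicator_of_notMem, hl, hp, hb,
      not_false_eq_true, mul_zero, hφ]
  ring

end NoiseLaw

theorem mainTheorem12 (p q : ℕ) (hq : 1 ≤ q) (hqp : q ≤ p) :
    IsProbabilityMeasure (mpcnNoiseLaw p q hqp 0) ∧
      Integrable (eigenvalueWeight p q) ∧
      0 < ∫ l, eigenvalueWeight p q l ∧
      AEMeasurable (orderedEigenvalues q) (mpcnNoiseLaw p q hqp 0) ∧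
      (mpcnNoiseLaw p q hqp 0).map (orderedEigenvalues q) =
        (volume : Measure (Fin q → ℝ)).withDensity fun l =>
          ENNReal.ofReal (eigenvalueWeight p q l / ∫ l', eigenvalueWeight p q l') := by
  have hprob : IsProbabilityMeasure (mpcnNoiseLaw p q hqp 0) := by
    refine ⟨?_⟩
    rw [mpcnNoiseLaw_zero, withDensity_apply _ MeasurableSet.univ, Measure.restrict_univ,
      lintegral_const_mul', mpcnConst_mul_lintegral p q hq hqp]
    exact ENNReal.ofReal_ne_top
  have hm : AEMeasurable (orderedEigenvalues q) (mpcnNoiseLaw p q hqp 0) :=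
    (measurable_orderedEigenvalues q).aemeasurable
  obtain ⟨K, hK⟩ := exists_map_orderedEigenvalues_mpcnNoiseLaw p q hqp
  set I := ∫⁻ l, ENNReal.ofReal (eigenvalueWeight p q l) with hI
  -- The image of a probability measure has mass one. In `ℝ≥0∞` this equation alone forces `I` to be
  -- neither `0` nor `∞`, which yields both positivity and integrability of the weight.
  have hKI : K * I = 1 := by
    have := Measure.isProbabilityMeasure_map hm
    have h1 := measure_univ (μ := (mpcnNoiseLaw p q hqp 0).map (orderedEigenvalues q))
    rwa [hK, Measure.smul_apply, withDensity_apply _ MeasurableSet.univ, Measure.restrict_univ,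
      smul_eq_mul] at h1
  have hI0 : I ≠ 0 := fun h => by simp [h] at hKI
  have hK0 : K ≠ 0 := fun h => by simp [h] at hKI
  have hIt : I ≠ ∞ := fun h => by simp [h, ENNReal.mul_top hK0] at hKI
  have hKinv : K = I⁻¹ := ENNReal.eq_inv_of_mul_eq_one_left hKI
  have hint : Integrable (eigenvalueWeight p q) :=
    (lintegral_ofReal_ne_top_iff_integrable
      (measurable_eigenvalueWeight p q).aestronglyMeasurable
      (Filter.Eventually.of_forall (eigenvalueWeight_nonneg p q))).mp hIt
  have hIint : ENNReal.ofReal (∫ l, eigenvalueWeight p q l) = I :=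
    ofReal_integral_eq_lintegral_ofReal hint
      (Filter.Eventually.of_forall (eigenvalueWeight_nonneg p q))
  have hpos : 0 < ∫ l, eigenvalueWeight p q l := by
    rw [← ENNReal.ofReal_pos, hIint]
    exact pos_iff_ne_zero.mpr hI0
  refine ⟨hprob, hint, hpos, hm, ?_⟩
  rw [hK, ← withDensity_smul _ (measurable_ofReal_eigenvalueWeight p q)]
  congr 1
  funext l
  rw [Pi.smul_apply, smul_eq_mul, ENNReal.ofReal_div_of_pos hpos, hIint, hKinv,
    ENNReal.div_eq_inv_mul]
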